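/- Let $K$ be a field and $E: y^2+a_1xy+a_3y=x^3+a_2x^2+a_4x+a_6$ an elliptic curve over $K$, with point at infinity $O$. **Trace.** For a finite extension $L/F$ of extension fields of $K$ and $P\in E(L)$, the trace $\operatorname{Tr}^L_F P$ is the point $R\in E(F)$ such that, for every algebraically closed field $\Omega$ and every embedding $i:F\to\Omega$, $$R^i=[L:F]_{\rm ins}\sum_{j} P^j,$$ where $j$ ranges over the embeddings $L\to\Omega$ extending $i$. **Kernel matrices.** A kernel matrix of a matrix $M$ over $K$ in echelon form is a matrix whose columns form a basis of the right kernel of $M$ and such that the number of consecutive zeros at the bottom of its $j$-th column is strictly decreasing in $j$. Fix a routine that returns such a matrix for every $M$. **Algorithm EllTraceSep$(E,T,(x_P,y_P))$**, where $T\in K[t]$ is irreducible and separable, $x_P,y_P\in K[t]$ have degree $<\deg T$, and $P=(x_P(\theta),y_P(\theta))$ is a point of $E(K(\theta))$, with $\theta$ the class of $t$ in $K(\theta)=K[t]/T(t)$. Let $d=\deg T$. 1. If $x_P$ is constant: return $[d]P$ if $y_P$ is constant too, and $O$ otherwise. 2. Let $\mathcal L[1]=1$, $\mathcal L[2]=x_P(\theta)$,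 $\mathcal L[3]=y_P(\theta)$, and $\mathcal L[j]=x_P(\theta)\mathcal L[j-2]$ for $4\le j\le d+1$. Let $M$ be the $d\times(d+1)$ matrix whose columns are the coordinates of $\mathcal L[1],\dots,\mathcal L[d+1]$ on $1,\theta,\dots,\theta^{d-1}$, and let $Z$ be the leftmost column of the kernel matrix of $M$ in echelon form given by the routine. 3. Let $U=Z[1]+\sum_{j=1}^{\lfloor (d+1)/2\rfloor}Z[2j]x^j$ and $V=\sum_{j=0}^{\lfloor (d-2)/2\rfloor}Z[2j+3]x^j$. If $V=0$, return $O$. 4. Let $X$ be the minimal polynomial of $x_P(\theta)$ over $K$, $R=(x^3+a_2x^2+a_4x+a_6)V^2+(a_1x+a_3)UV-U^2$ and $S=R/X$. If $\deg S=0$, return $O$. 5. Let $x_Q$ be the unique root of $S$, $y_Q=-U(x_Q)/V(x_Q)$, $Q=(x_Q,y_Q)$, and let $d_P$ be the largest $j\le d$ with $Z[j+1]\ne0$. Return $[-d/d_P]Q$. **Algorithm EllTrace$(E,T,(x_P,y_P))$**, with the same input except that the irreducible polynomial $T$ need not be separable. If $\operatorname{char}K=0$, return EllTraceSep$(E,T,(x_P,y_P))$.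 If $\operatorname{char}K=p>0$, let $d\ge0$ be the largest integer with $T(t)\in K[t^{p^d}]$, let $S$ be the polynomial with $T(t)=S(t^{p^d})$, and let $Q=[p^d]P$. If $Q=O$, return $O$. Otherwise let $x_Q(t),y_Q(t)\in K[t]$ be the polynomials of degree $<\deg S$ with $Q=(x_Q(\theta^{p^d}),y_Q(\theta^{p^d}))$, and return EllTraceSep$(E,S,(x_Q,y_Q))$. **Theorem.** Let $T\in K[t]$ be irreducible, let $L=K(\theta)=K[t]/T(t)$, where $\theta$ is the class of $t$, and let $x_P,y_P\in K[t]$ be polynomials of degree $<\deg T$ such that $P=(x_P(\theta),y_P(\theta))\in E(L)$. Then $\operatorname{Tr}^L_K P$ exists, every step of EllTrace$(E,T,(x_P,y_P))$ can be carried out, and it returns $\operatorname{Tr}^L_K P$. Moreover, let $p$ be the characteristic exponent of $K$ ($p=1$ if $\operatorname{char}K=0$). There are $d\ge 0$ and a separable $S\in K[t]$ with $T(t)=S(t^{p^d})$, and for all such $d$ and $S$: * $S$ is irreducible; if $p>1$, then $d$ is the largest integer with $T(t)\in K[t^{p^d}]$; $[L:K]_{\rm ins}=p^d$; and $K(\theta^{p^d})$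 is the separable closure $L_{\rm sep}$ of $K$ in $L$. * The point $Q=[p^d]P$ lies in $E(K(\theta^{p^d}))$, $Q=\operatorname{Tr}^L_{L_{\rm sep}}P$, and $\operatorname{Tr}^L_KP=\operatorname{Tr}^{K(\theta^{p^d})}_K Q$. * If $Q\ne O$, there is exactly one pair of polynomials $x_Q(t),y_Q(t)\in K[t]$ of degree $<\deg S$ with $Q=(x_Q(\theta^{p^d}),y_Q(\theta^{p^d}))$. With $\theta'$ the class of $t$ in $K[t]/S(t)$, the pair $(x_Q(\theta'),y_Q(\theta'))$ is a point of $E(K[t]/S(t))$, and EllTraceSep$(E,S,(x_Q,y_Q))$ can be carried out and returns $\operatorname{Tr}^L_KP$. -/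

import Mathlib

open Polynomial IntermediateField WeierstrassCurve
open scoped Classical

universe u

instance adjoinRoot_finiteDimensional {K : Type u} [Field K] (T : K[X]) [hT : Fact (Irreducible T)] :
    FiniteDimensional K (AdjoinRoot T) :=
  Module.Finite.of_basis (AdjoinRoot.powerBasis hT.out.ne_zero).basis

instance baseChange_isElliptic {K L : Type u} [Field K] [Field L] [Algebra K L]
    (E : WeierstrassCurve K) [E.IsElliptic] : (E⁄L).toAffine.IsElliptic :=
  inferInstanceAs (E.map (algebraMap K L)).IsElliptic

/-! ### The trace of a point -/

/-- Let `F ⊆ L` be a finite extension of fields containing `k`, and let `E` be defined over `k`.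
`IsTrace E P R` says that the point `R` of `E(F)` is the trace of the point `P` of `E(L)` relative
to `L / F`: for every algebraically closed field `Ω` and every embedding `i : F → Ω`,
`R^i = [L : F]_ins ∑_j P^j`, where `j` ranges over the (finitely many) embeddings `L → Ω` that
extend `i`. The given `k`-algebra structure on `Ω` is the restriction of `i` to `k`. -/
def IsTrace {k F L : Type u} [Field k] [Field F] [Field L] [Algebra k F] [Algebra k L]
    [Algebra F L] [IsScalarTower k F L] [FiniteDimensional F L] (E : WeierstrassCurve k)
    (P : (E⁄L).toAffine.Point) (R : (E⁄F).toAffine.Point) : Prop :=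
  ∀ (Ω : Type u) [Field Ω] [IsAlgClosed Ω] [Algebra k Ω] (i : F →ₐ[k] Ω),
    Affine.Point.map i R = Field.finInsepDegree F L •
      ∑ᶠ j : {j : L →ₐ[k] Ω // ∀ x : F, j (algebraMap F L x) = i x}, Affine.Point.map j.1 P

/-- `HasCoords E θ Q (x, y)` says that `Q` is the affine point `(x(θ), y(θ))` of `E(L)`. -/
def HasCoords {K L : Type u} [Field K] [Field L] [Algebra K L] (E : WeierstrassCurve K)
    [E.IsElliptic] (θ : L) (Q : (E⁄L).toAffine.Point) (f : K[X] × K[X]) : Prop :=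
  ∃ h : (E⁄L).toAffine.Equation (aeval θ f.1) (aeval θ f.2), Q = Affine.Point.mk h

/-! ### Kernel matrices in echelon form -/

/-- The number of consecutive zeros at the bottom of a vector of length `n`. -/
noncomputable def bottomZeros {K : Type u} [Field K] {n : ℕ} (v : Fin n → K) : ℕ :=
  Nat.findGreatest (fun c => ∀ i : Fin n, n ≤ i + c → v i = 0) n

/-- `Z` is a kernel matrix of `M` in echelon form: its columns form a basis of the right kernel of
`M`, and the number of consecutive zeros at the bottom of the `j`-th column is a strictly
decreasing function of `j`. -/
structure IsEchelonKernel {K : Type u} [Field K] {m n r : ℕ} (M : Matrix (Fin m) (Fin n) K)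
    (Z : Matrix (Fin n) (Fin r) K) : Prop where
  linearIndependent : LinearIndependent K Z.col
  span_eq : Submodule.span K (Set.range Z.col) = LinearMap.ker M.mulVecLin
  strictAnti : StrictAnti fun j => bottomZeros (Z.col j)

theorem le_bottomZeros_iff {K : Type u} [Field K] {n : ℕ} (v : Fin n → K) {c : ℕ} (hc : c ≤ n) :
    c ≤ bottomZeros v ↔ ∀ i : Fin n, n ≤ i + c → v i = 0 := by
  constructor
  · intro h i hi
    have := Nat.findGreatest_spec (P := fun c => ∀ i : Fin n, n ≤ i + c → v i = 0) (n := n)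
      (Nat.zero_le n) (fun i hi => absurd i.2 (by omega))
    exact this i (by unfold bottomZeros at h; omega)
  · intro h
    exact Nat.le_findGreatest hc h

theorem exists_isEchelonKernel {K : Type u} [Field K] {m n : ℕ} (M : Matrix (Fin m) (Fin n) K) :
    ∃ (r : ℕ) (Z : Matrix (Fin n) (Fin r) K), IsEchelonKernel M Z := by
  let W : ℕ → Submodule K (Fin n → K) := fun k =>
    LinearMap.ker M.mulVecLin ⊓
      { carrier := {v | ∀ i : Fin n, k ≤ i → v i = 0}
        add_mem' := fun {a b} ha hb i hi => by simp [ha i hi, hb i hi]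
        zero_mem' := fun i _ => rfl
        smul_mem' := fun c a ha i hi => by simp [ha i hi] }
  have hmem : ∀ k v, v ∈ W k ↔ v ∈ LinearMap.ker M.mulVecLin ∧ ∀ i : Fin n, k ≤ i → v i = 0 :=
    fun k v => Iff.rfl
  have key : ∀ k, k ≤ n → ∃ (r : ℕ) (v : Fin r → Fin n → K), LinearIndependent K v ∧
      Submodule.span K (Set.range v) = W k ∧ StrictAnti fun j => bottomZeros (v j) := by
    intro k
    induction k with
    | zero =>
      intro _
      refine ⟨0, Fin.elim0, linearIndependent_empty_type, ?_, fun j => j.elim0⟩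
      rw [Set.range_eq_empty, Submodule.span_empty, eq_comm, eq_bot_iff]
      intro v hv
      exact funext fun i => ((hmem 0 v).1 hv).2 i (Nat.zero_le _)
    | succ k ih =>
      intro hk
      obtain ⟨r, v, hli, hsp, hanti⟩ := ih (by omega)
      have hle : W k ≤ W (k + 1) := fun x hx =>
        (hmem _ _).2 ⟨((hmem _ _).1 hx).1, fun i hi => ((hmem _ _).1 hx).2 i (by omega)⟩
      by_cases h : W (k + 1) ≤ W k
      · exact ⟨r, v, hli, hsp.trans (le_antisymm hle h), hanti⟩
      obtain ⟨w, hw, hwk⟩ := Set.not_subset.1 h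
      have hw0 : w ⟨k, hk⟩ ≠ 0 := fun h0 => hwk <| (hmem _ _).2
        ⟨((hmem _ _).1 hw).1, fun i hi => by
          rcases Nat.eq_or_lt_of_le hi with he | hl
          · have : i = ⟨k, hk⟩ := Fin.ext he.symm
            rw [this, h0]
          · exact ((hmem _ _).1 hw).2 i hl⟩
      refine ⟨r + 1, Fin.snoc v w, linearIndependent_finSnoc.2 ⟨hli, by rw [hsp]; exact hwk⟩, ?_, ?_⟩
      · rw [Fin.range_snoc, Submodule.span_insert, hsp]
        refine le_antisymm (sup_le ((Submodule.span_singleton_le_iff_mem _ _).2 hw) hle) ?_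
        intro x hx
        refine Submodule.mem_sup.2 ⟨(x ⟨k, hk⟩ / w ⟨k, hk⟩) • w,
          Submodule.smul_mem _ _ (Submodule.mem_span_singleton_self w),
          x - (x ⟨k, hk⟩ / w ⟨k, hk⟩) • w, ?_, by abel⟩
        have hd : x - (x ⟨k, hk⟩ / w ⟨k, hk⟩) • w ∈ W (k + 1) :=
          Submodule.sub_mem _ hx (Submodule.smul_mem _ _ hw)
        refine (hmem _ _).2 ⟨((hmem _ _).1 hd).1, fun i hi => ?_⟩
        rcases Nat.eq_or_lt_of_le hi with he | hl
        · have : i = ⟨k, hk⟩ := Fin.ext he.symm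
          subst this
          simp [hw0]
        · exact ((hmem _ _).1 hd).2 i hl
      · have hlast : ∀ j, bottomZeros w < bottomZeros (v j) := by
          intro j
          have h1 : n - k ≤ bottomZeros (v j) := by
            rw [le_bottomZeros_iff _ (by omega)]
            intro i hi
            have hj : v j ∈ W k := hsp ▸ Submodule.subset_span ⟨j, rfl⟩
            exact ((hmem _ _).1 hj).2 i (by omega)
          have h2 : ¬ n - k ≤ bottomZeros w := by
            rw [le_bottomZeros_iff _ (by omega)]
            intro h
            exact hw0 (h ⟨k, hk⟩ (by simp only; omega))
          omega
        intro a b hab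
        induction a using Fin.lastCases with
        | last => exact absurd hab (not_lt.2 (Fin.le_last b))
        | cast a =>
          induction b using Fin.lastCases with
          | last => simpa using hlast a
          | cast b => simpa using hanti (by simpa using hab)
  obtain ⟨r, v, hli, hsp, hanti⟩ := key n le_rfl
  refine ⟨r, (Matrix.of v).transpose, hli, hsp.trans (le_antisymm inf_le_left ?_), hanti⟩
  exact fun x hx => (hmem _ _).2 ⟨hx, fun i hi => absurd i.2 (by omega)⟩

/-- A linear algebra routine that returns, for each matrix `M` over `K`, some kernel matrix of `M`
in echelon form. -/
structure KernelRoutine (K : Type u) [Field K] where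
  numCols : ∀ {m n : ℕ}, Matrix (Fin m) (Fin n) K → ℕ
  mat : ∀ {m n : ℕ} (M : Matrix (Fin m) (Fin n) K), Matrix (Fin n) (Fin (numCols M)) K
  isEchelonKernel : ∀ {m n : ℕ} (M : Matrix (Fin m) (Fin n) K), IsEchelonKernel M (mat M)

instance {K : Type u} [Field K] : Nonempty (KernelRoutine K) :=
  ⟨⟨fun M => (exists_isEchelonKernel M).choose, fun M => (exists_isEchelonKernel M).choose_spec.choose,
    fun M => (exists_isEchelonKernel M).choose_spec.choose_spec⟩⟩

/-! ### The algorithms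

Elements of `K[t]/T(t)` are represented by their unique representative of degree `< deg T`.
The value `none` means that some step of the algorithm cannot be carried out. -/

/-- The list `ℒ`, indexed from `1`: `ℒ[1] = 1`, `ℒ[2] = x_P(θ)`, `ℒ[3] = y_P(θ)` and
`ℒ[j] = x_P(θ) ℒ[j - 2]` for `j ≥ 4`. -/
noncomputable def valueList {K : Type u} [Field K] (T xP yP : K[X]) : ℕ → K[X]
  | 0 => 0
  | 1 => 1
  | 2 => xP
  | 3 => yP
  | (j + 4) => (xP * valueList T xP yP (j + 2)) % T

/-- The matrix, of size `d × (d + 1)` where `d = deg T`, whose columns are the coordinates of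
`ℒ[1], …, ℒ[d + 1]` with respect to `1, θ, …, θ ^ (d - 1)`. -/
noncomputable def valueMatrix {K : Type u} [Field K] (T xP yP : K[X]) :
    Matrix (Fin T.natDegree) (Fin (T.natDegree + 1)) K :=
  fun i j => (valueList T xP yP (j + 1)).coeff i

/-- The entry `z[j]` of a vector, where the indices start at `1`. -/
noncomputable def entry {K : Type u} [Field K] {n : ℕ} (z : Fin n → K) (j : ℕ) : K :=
  if h : j - 1 < n then z ⟨j - 1, h⟩ else 0

/-- The polynomial `U(x) = Z[1] + ∑_{j=1}^{⌊(d+1)/2⌋} Z[2j] x^j`. -/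
noncomputable def polyU {K : Type u} [Field K] {d : ℕ} (z : Fin (d + 1) → K) : K[X] :=
  C (entry z 1) + ∑ j ∈ Finset.Icc 1 ((d + 1) / 2), C (entry z (2 * j)) * X ^ j

/-- The polynomial `V(x) = ∑_{j=0}^{⌊(d-2)/2⌋} Z[2j+3] x^j`, for `d ≥ 2`. -/
noncomputable def polyV {K : Type u} [Field K] {d : ℕ} (z : Fin (d + 1) → K) : K[X] :=
  ∑ j ∈ Finset.Icc 0 ((d - 2) / 2), C (entry z (2 * j + 3)) * X ^ j

/-- The polynomial `R = (x³ + a₂x² + a₄x + a₆) V² + (a₁x + a₃) U V - U²`. -/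
noncomputable def polyR {K : Type u} [Field K] (E : WeierstrassCurve K) (U V : K[X]) : K[X] :=
  (X ^ 3 + C E.a₂ * X ^ 2 + C E.a₄ * X + C E.a₆) * V ^ 2
    + (C E.a₁ * X + C E.a₃) * U * V - U ^ 2

/-- The part of `EllTraceSep` that follows the computation of the leftmost column `z` of a kernel
matrix in echelon form. -/
noncomputable def ellTraceSepOfColumn {K : Type u} [Field K] (E : WeierstrassCurve K)
    [E.IsElliptic] (T xP : K[X]) (z : Fin (T.natDegree + 1) → K) :
    Option (E⁄K).toAffine.Point :=
  let d := T.natDegree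
  let U := polyU z
  let V := polyV z
  if V = 0 then some 0 else
  let mp := minpoly K (AdjoinRoot.mk T xP)
  let R := polyR E U V
  if ¬ mp ∣ R then none else
  let S := R / mp
  if S.degree = 0 then some 0 else
  if hx : ∃! x, S.IsRoot x then
    let xQ := hx.choose
    if V.eval xQ = 0 then none else
    let yQ := -U.eval xQ / V.eval xQ
    if hQ : (E⁄K).toAffine.Equation xQ yQ then
      let Q : (E⁄K).toAffine.Point := Affine.Point.mk hQ
      let dP := Nat.findGreatest (fun j => entry z (j + 1) ≠ 0) d
      if dP ∣ d then some ((-((d / dP : ℕ) : ℤ)) • Q) else none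
    else none
  else none

/-- The algorithm `EllTraceSep`. -/
noncomputable def ellTraceSep {K : Type u} [Field K] (ker : KernelRoutine K)
    (E : WeierstrassCurve K) [E.IsElliptic] (T xP yP : K[X]) :
    Option (E⁄K).toAffine.Point :=
  if xP.natDegree = 0 then
    if yP.natDegree = 0 then
      if hP : (E⁄K).toAffine.Equation (xP.coeff 0) (yP.coeff 0) then
        some (T.natDegree • (Affine.Point.mk hP : (E⁄K).toAffine.Point))
      else none
    else some 0
  else
    let M := valueMatrix T xP yP
    if hr : 0 < ker.numCols M then
      ellTraceSepOfColumn E T xP ((ker.mat M).col ⟨0, hr⟩)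
    else none

/-- The algorithm `EllTrace`. An exponent `e` with `T(t) ∈ K[t ^ (p ^ e)]` is less than `deg T`,
which bounds the search for the largest one. -/
noncomputable def ellTrace {K : Type u} [Field K] (ker : KernelRoutine K)
    (E : WeierstrassCurve K) [E.IsElliptic] (T : K[X]) [Fact (Irreducible T)] (xP yP : K[X])
    (hP : (E⁄(AdjoinRoot T)).toAffine.Equation
      (aeval (AdjoinRoot.root T) xP) (aeval (AdjoinRoot.root T) yP)) :
    Option (E⁄K).toAffine.Point :=
  let θ := AdjoinRoot.root T
  let P : (E⁄(AdjoinRoot T)).toAffine.Point := Affine.Point.mk hP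
  let p := ringChar K
  if p ≠ 0 then
    let d := Nat.findGreatest (fun e => ∃ S : K[X], T = expand K (p ^ e) S) T.natDegree
    let S := contract (p ^ d) T
    let Q := p ^ d • P
    if Q = 0 then some 0 else
    if h : ∃ f : K[X] × K[X], f.1.degree < S.degree ∧ f.2.degree < S.degree ∧
        HasCoords E (θ ^ p ^ d) Q f then
      ellTraceSep ker E S h.choose.1 h.choose.2
    else none
  else ellTraceSep ker E T xP yP

/-! Separable case. Put `x = x_P(θ)`, `y = y_P(θ)` and let `A` be the minimal polynomial of `x`. If
`y ∉ K(x)`, the conjugates of `P` over `K(x)` cancel in pairs `±`, and the trace is `O`. If `y =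
g(x)`, the trace is `[L : K(x)] • s`, where `s` is the sum of the points `(r, g(r))` over the roots
`r` of `A`. A function `f = U + V y` over `K` that vanishes at `P` vanishes at all these points. A
dimension count gives such an `f ≠ 0` with pole order at most `deg A + 1`. For `f` of least pole
order, the norm of `f` is therefore `A S` up to sign, with `deg S ≤ 1`. Either `S` is constant and
`s = 0`, or `f` has one further zero `Q` and `s = -Q`. The list `1, x, y, x², xy, …` is sorted by
pole order, so the leftmost column of an echelon kernel matrix is such an `f`.

Divisors are replaced by ideals of the coordinate ring: `Represents I P A` records that `I` has the
class of `P` and norm `A`. A function in `I` of norm `A` generates `I`, whence `P = 0` by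
injectivity of the map from points to classes (`Represents.eq_zero`). The analysis of a minimal
function is `IsMinRel.polyR_eq`.

Inseparable case. With `q = p ^ d`, `L` is purely inseparable of degree `q` over `F = K(θ ^ q)`, so
each embedding of `F` extends uniquely and the trace to `F` must be `q • P`. Its rationality over
`F` (`pow_nsmul_mem_range`) follows from the same argument, with `A = X ^ q - x ^ q` and the `q`-th
power of the ideal of `P` in place of a product over conjugates. The separable case
(`ellTraceSep_correct`) then applies to `F`, and `exists_isTrace` combines the two. -/

namespace WeierstrassCurve.Affine.CoordinateRing

/-! ### Ideals of the coordinate ring representing points -/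

open scoped nonZeroDivisors Polynomial.Bivariate

variable {F : Type u} [Field F] {W : Affine F}

/-- The involution of the coordinate ring induced by negation on the curve. -/
noncomputable def conj (W : Affine F) : W.CoordinateRing →+* W.CoordinateRing :=
  AdjoinRoot.lift (AdjoinRoot.of W.polynomial) (mk W W.negPolynomial) <| by
    -- The Weierstrass polynomial, quadratic in `Y`, is unchanged when `Y` is replaced by its other
    -- root `negPolynomial`.
    have h : W.negPolynomial ^ 2 + C (C W.a₁ * X + C W.a₃) * W.negPolynomial
        - C (X ^ 3 + C W.a₂ * X ^ 2 + C W.a₄ * X + C W.a₆) = W.polynomial := by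
      rw [negPolynomial, WeierstrassCurve.Affine.polynomial]
      ring1
    have h' := congrArg (mk W) h
    rw [AdjoinRoot.mk_self] at h'
    refine (congrArg (eval₂ (AdjoinRoot.of W.polynomial) (mk W W.negPolynomial))
      (show W.polynomial = Y ^ 2 + C (C W.a₁ * X + C W.a₃) * Y
        - C (X ^ 3 + C W.a₂ * X ^ 2 + C W.a₄ * X + C W.a₆) from rfl)).trans ?_
    rw [eval₂_sub, eval₂_add, eval₂_mul, eval₂_pow, eval₂_X,
      eval₂_C, eval₂_C, ← AdjoinRoot.mk_C, ← AdjoinRoot.mk_C, ← map_mul, ← map_pow, ← map_add,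
      ← map_sub]
    exact h'

lemma conj_mk_C (p : F[X]) : conj W (mk W (C p)) = mk W (C p) := by
  rw [conj, AdjoinRoot.lift_mk, eval₂_C, AdjoinRoot.mk_C]

lemma conj_mk_Y : conj W (mk W Y) = mk W W.negPolynomial := by
  rw [conj, AdjoinRoot.lift_mk, eval₂_X]

lemma mk_C_norm (f : W.CoordinateRing) :
    mk W (C (Algebra.norm F[X] f)) = f * conj W f := by
  obtain ⟨p, q, rfl⟩ := exists_smul_basis_eq f
  have h := coe_norm_smul_basis (W' := W) p q
  have h2 : mk W (C (Algebra.norm F[X] (p • (1 : W.CoordinateRing) + q • mk W Y))) =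
    ((Algebra.norm F[X] (p • (1 : W.CoordinateRing) + q • mk W Y) : F[X]) : W.CoordinateRing) := rfl
  rw [h2, h]
  simp only [smul, map_add, map_mul, conj_mk_C, conj_mk_Y, negPolynomial, map_one]
  ring

lemma conj_XYIdeal (x y : F) :
    (XYIdeal W x (C y)).map (conj W) = XYIdeal W x (C (W.negY x y)) := by
  have h1 : conj W (XClass W x) = XClass W x := conj_mk_C _
  have h2 : conj W (YClass W (C y)) =
      -YClass W (C (W.negY x y)) + mk W (C (-C W.a₁)) * XClass W x := by
    rw [YClass, map_sub, map_sub, conj_mk_C, conj_mk_Y, YClass, XClass, ← map_mul, ← map_neg,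
      ← map_add, ← map_sub]
    congr 1
    rw [negPolynomial, negY]
    simp only [C_neg, C_add, C_sub, C_mul]
    ring1
  have h3 : YClass W (C (W.negY x y)) =
      -conj W (YClass W (C y)) + mk W (C (-C W.a₁)) * XClass W x := by
    rw [h2]; ring
  rw [XYIdeal, XYIdeal, Ideal.map_span, Set.image_pair, h1]
  apply le_antisymm <;> rw [Ideal.span_le, Set.pair_subset_iff]
  · refine ⟨Ideal.subset_span (by simp), ?_⟩
    rw [h2]
    exact Ideal.add_mem _ (neg_mem (Ideal.subset_span (by simp)))
      (Ideal.mul_mem_left _ _ (Ideal.subset_span (by simp)))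
  · refine ⟨Ideal.subset_span (by simp), ?_⟩
    rw [h3]
    exact Ideal.add_mem _ (neg_mem (Ideal.subset_span (by simp)))
      (Ideal.mul_mem_left _ _ (Ideal.subset_span (by simp)))

/-- The ideal `I` is invertible of class `P`, and `I` times its conjugate is generated by the
polynomial `A`. -/
structure Represents (I : Ideal W.CoordinateRing) (P : W.Point) (A : F[X]) : Prop where
  class_eq : ∃ u : (FractionalIdeal W.CoordinateRing⁰ W.FunctionField)ˣ,
    (u : FractionalIdeal W.CoordinateRing⁰ W.FunctionField) = I ∧
      ClassGroup.mk W.FunctionField u = (Point.toClass P).toMul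
  conj_isUnit : IsUnit ((I.map (conj W) : Ideal W.CoordinateRing) :
    FractionalIdeal W.CoordinateRing⁰ W.FunctionField)
  mul_conj : I * I.map (conj W) = Ideal.span {CoordinateRing.mk W (C A)}

lemma represents_top : Represents (⊤ : Ideal W.CoordinateRing) 0 1 where
  class_eq := ⟨1, by simp, by simp⟩
  conj_isUnit := by simp [Ideal.map_top]
  mul_conj := by simp [Ideal.map_top]

lemma Represents.mul {I J : Ideal W.CoordinateRing} {P Q : W.Point} {A B : F[X]}
    (hI : Represents I P A) (hJ : Represents J Q B) : Represents (I * J) (P + Q) (A * B) where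
  class_eq := by
    obtain ⟨u, hu, hu'⟩ := hI.class_eq
    obtain ⟨v, hv, hv'⟩ := hJ.class_eq
    exact ⟨u * v, by simp [hu, hv], by rw [map_mul, hu', hv', map_add, toMul_add]⟩
  conj_isUnit := by
    rw [Ideal.map_mul, FractionalIdeal.coeIdeal_mul]
    exact hI.conj_isUnit.mul hJ.conj_isUnit
  mul_conj := by
    rw [Ideal.map_mul, mul_mul_mul_comm, hI.mul_conj, hJ.mul_conj,
      Ideal.span_singleton_mul_span_singleton, ← map_mul, ← map_mul]

lemma represents_XYIdeal {x y : F} (h : W.Nonsingular x y) :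
    Represents (XYIdeal W x (C y)) (.some x y h) (X - C x) where
  class_eq := ⟨XYIdeal' h, XYIdeal'_eq h, by rw [Point.toClass_some]; rfl⟩
  conj_isUnit := by
    rw [conj_XYIdeal, ← XYIdeal'_eq ((nonsingular_neg ..).mpr h)]
    exact Units.isUnit _
  mul_conj := by
    rw [conj_XYIdeal, mul_comm, XYIdeal_neg_mul h]; rfl

lemma Represents.pow {I : Ideal W.CoordinateRing} {P : W.Point} {A : F[X]}
    (hI : Represents I P A) (n : ℕ) : Represents (I ^ n) (n • P) (A ^ n) := by
  induction n with
  | zero => simpa [Ideal.one_eq_top] using represents_top (W := W)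
  | succ n ih => simpa [pow_succ, succ_nsmul] using ih.mul hI

lemma Represents.prod {ι : Type*} (s : Finset ι) {I : ι → Ideal W.CoordinateRing} {P : ι → W.Point}
    {A : ι → F[X]} (h : ∀ i ∈ s, Represents (I i) (P i) (A i)) :
    Represents (∏ i ∈ s, I i) (∑ i ∈ s, P i) (∏ i ∈ s, A i) := by
  induction s using Finset.induction_on with
  | empty => simpa [Ideal.one_eq_top] using represents_top (W := W)
  | insert a s ha ih =>
    rw [Finset.prod_insert ha, Finset.sum_insert ha, Finset.prod_insert ha]
    exact (h a (by simp)).mul (ih fun i hi => h i (by simp [hi]))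

lemma Represents.mk_C_mem {I : Ideal W.CoordinateRing} {P : W.Point} {A : F[X]}
    (hI : Represents I P A) : CoordinateRing.mk W (C A) ∈ I := by
  have h : CoordinateRing.mk W (C A) ∈ I * I.map (conj W) := by
    rw [hI.mul_conj]
    exact Ideal.mem_span_singleton_self _
  have h2 : I * I.map (conj W) ≤ I := Ideal.mul_le_left
  exact h2 h

lemma mk_C_mem_of_dvd {I : Ideal W.CoordinateRing} {A B : F[X]} (hA : CoordinateRing.mk W (C A) ∈ I)
    (h : A ∣ B) : CoordinateRing.mk W (C B) ∈ I := by
  obtain ⟨D, rfl⟩ := h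
  rw [C_mul, map_mul]
  exact Ideal.mul_mem_right _ _ hA

lemma isCoprime_of_mk_C_mem {I J : Ideal W.CoordinateRing} {A B : F[X]} (hA : mk W (C A) ∈ I)
    (hB : mk W (C B) ∈ J) (h : IsCoprime A B) : IsCoprime I J := by
  obtain ⟨a, b, hab⟩ := h
  rw [Ideal.isCoprime_iff_exists]
  refine ⟨mk W (C (a * A)), mk_C_mem_of_dvd hA (dvd_mul_left _ _), mk W (C (b * B)),
    mk_C_mem_of_dvd hB (dvd_mul_left _ _), ?_⟩
  rw [← map_add, ← map_add, hab, map_one, map_one]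

lemma mk_C_mem_XYIdeal (x y : F) : mk W (C (X - C x)) ∈ XYIdeal W x (C y) :=
  Ideal.subset_span (Or.inl rfl)

lemma mk_Y_sub_C_mem_XYIdeal (x : F) (g : F[X]) :
    mk W (Y - C g) ∈ XYIdeal W x (C (g.eval x)) := by
  have h : mk W (Y - C g) = YClass W (C (g.eval x)) - mk W (C (g - C (g.eval x))) := by
    rw [YClass, ← map_sub]
    congr 1
    rw [C_sub]
    ring
  rw [h]
  exact sub_mem (Ideal.subset_span (Or.inr rfl))
    (mk_C_mem_of_dvd (mk_C_mem_XYIdeal x _) (X_sub_C_dvd_sub_C_eval))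

/-- The norm `f * conj f` lies in `I * conj I = (A)`; comparing coordinates on the basis `1, Y`
turns this into divisibility of polynomials. -/
lemma Represents.norm_dvd {I : Ideal W.CoordinateRing} {P : W.Point} {A : F[X]}
    (hI : Represents I P A) {f : W.CoordinateRing} (hf : f ∈ I) : A ∣ Algebra.norm F[X] f := by
  generalize hN : Algebra.norm F[X] f = N
  have h : CoordinateRing.mk W (C N) ∈ Ideal.span {CoordinateRing.mk W (C A)} := by
    rw [← hN, mk_C_norm, ← hI.mul_conj]
    exact Ideal.mul_mem_mul hf (Ideal.mem_map_of_mem _ hf)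
  obtain ⟨g, hg⟩ := Ideal.mem_span_singleton'.1 h
  obtain ⟨p, q, rfl⟩ := exists_smul_basis_eq g
  rw [smul_basis_mul_C] at hg
  have h0 : (p * A - N) • (1 : W.CoordinateRing) + (q * A) • CoordinateRing.mk W Y = 0 := by
    rw [sub_smul, sub_add_eq_add_sub, hg, smul, mul_one, sub_self]
  rw [← sub_eq_zero.1 (smul_basis_eq_zero h0).1]
  exact dvd_mul_left _ _

/-- A function in `I` whose norm generates the norm of `I` has divisor `I`. -/
lemma Represents.eq_zero {I : Ideal W.CoordinateRing} {P : W.Point} {A : F[X]}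
    (hI : Represents I P A) {f : W.CoordinateRing} (hf : f ∈ I) (hf0 : f ≠ 0)
    (h : Associated (Algebra.norm F[X] f) A) : P = 0 := by
  have hspan : Ideal.span {f} * Ideal.span {conj W f} = I * I.map (conj W) := by
    rw [hI.mul_conj, Ideal.span_singleton_mul_span_singleton, ← mk_C_norm,
      Ideal.span_singleton_eq_span_singleton]
    exact h.map ((CoordinateRing.mk W).comp C)
  have hle : I * I.map (conj W) ≤ Ideal.span {f} * I.map (conj W) := by
    rw [← hspan]
    exact Ideal.mul_mono_right ((Ideal.span_singleton_le_iff_mem _).2 (Ideal.mem_map_of_mem _ hf))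
  -- The conjugate ideal is invertible, so it cancels from `I * conj I ≤ (f) * conj I`.
  have hle' : I ≤ Ideal.span {f} := by
    obtain ⟨v, hv⟩ := hI.conj_isUnit
    rw [← FractionalIdeal.coeIdeal_le_coeIdeal W.FunctionField, FractionalIdeal.coeIdeal_mul,
      FractionalIdeal.coeIdeal_mul, ← hv] at hle
    rw [← FractionalIdeal.coeIdeal_le_coeIdeal W.FunctionField]
    have h2 := mul_le_mul_left hle (↑v⁻¹ : FractionalIdeal W.CoordinateRing⁰ W.FunctionField)
    simpa only [Units.mul_inv_cancel_right] using h2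
  have hI' : I = Ideal.span {f} :=
    le_antisymm hle' ((Ideal.span_singleton_le_iff_mem _).2 hf)
  obtain ⟨u, hu, hu'⟩ := hI.class_eq
  rw [← Point.toClass_eq_zero, ← toMul_eq_one, ← hu', ClassGroup.mk_eq_one_of_coe_ideal hu]
  exact ⟨f, hf0, hI'⟩

end WeierstrassCurve.Affine.CoordinateRing

/-! ### Functions of minimal pole order and their norms -/

namespace EllTrace

open scoped Polynomial.Bivariate

variable {F : Type u} [Field F]

/-- The pole order at infinity of the function `U(x) + V(x) y`. -/
noncomputable def poleOrder (U V : F[X]) : ℕ :=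
  if V = 0 then 2 * U.natDegree else max (2 * U.natDegree) (2 * V.natDegree + 3)

open WeierstrassCurve.Affine in
lemma polyR_eq_neg_norm (W : WeierstrassCurve F) (U V : F[X]) :
    polyR W U V = -Algebra.norm F[X]
      (U • (1 : W.toAffine.CoordinateRing) + V • CoordinateRing.mk W.toAffine Y) := by
  rw [CoordinateRing.norm_smul_basis, polyR]
  ring

lemma polyR_map {L : Type u} [Field L] (φ : F →+* L) (W : WeierstrassCurve F) (U V : F[X]) :
    polyR (W.map φ) (U.map φ) (V.map φ) = (polyR W U V).map φ := by
  simp [polyR]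

/-- The pole orders of `U` (even) and of `V y` (odd) never coincide, so leading terms of the norm
cannot cancel. -/
lemma degree_polyR (W : WeierstrassCurve F) {U V : F[X]} (h : U ≠ 0 ∨ V ≠ 0) :
    (polyR W U V).degree = poleOrder U V := by
  rw [polyR_eq_neg_norm, degree_neg, Affine.CoordinateRing.degree_norm_smul_basis, poleOrder]
  split_ifs with hV
  · have hU : U ≠ 0 := by tauto
    rw [hV, degree_eq_natDegree hU]
    simp [nsmul_eq_mul]
  · by_cases hU : U = 0
    · rw [hU, degree_eq_natDegree hV]
      simp [nsmul_eq_mul]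
    · rw [degree_eq_natDegree hV, degree_eq_natDegree hU]
      simp only [nsmul_eq_mul]
      norm_cast

lemma polyR_ne_zero (W : WeierstrassCurve F) {U V : F[X]} (h : U ≠ 0 ∨ V ≠ 0) :
    polyR W U V ≠ 0 := by
  intro h0
  have := degree_polyR W h
  simp [h0] at this

lemma natDegree_polyR (W : WeierstrassCurve F) {U V : F[X]} (h : U ≠ 0 ∨ V ≠ 0) :
    (polyR W U V).natDegree = poleOrder U V :=
  natDegree_eq_of_degree_eq_some (degree_polyR W h)

/-- `U + V y` is a nonzero function of minimal pole order among those for which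
`U + V h` is divisible by `A`. -/
structure IsMinRel (A h U V : F[X]) : Prop where
  ne_zero : U ≠ 0 ∨ V ≠ 0
  dvd : A ∣ U + V * h
  poleOrder_le : ∀ U' V' : F[X], (U' ≠ 0 ∨ V' ≠ 0) → A ∣ U' + V' * h →
    poleOrder U V ≤ poleOrder U' V'

lemma exists_rel {A : F[X]} (hA : A ≠ 0) (h : F[X]) :
    ∃ U V : F[X], (U ≠ 0 ∨ V ≠ 0) ∧ A ∣ U + V * h ∧ poleOrder U V ≤ A.natDegree + 1 := by
  set n := A.natDegree with hn
  -- The degree bounds allow exactly the monomials of pole order at most `n + 1`. There are `(n + 1)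
  -- / 2 + 1 + n / 2 = n + 1` of them, against `n` linear conditions.
  let φ : (degreeLT F ((n + 1) / 2 + 1) × degreeLT F (n / 2)) →ₗ[F] AdjoinRoot A :=
    ((AdjoinRoot.mkₐ A).toLinearMap ∘ₗ (degreeLT F ((n + 1) / 2 + 1)).subtype).coprod
      ((LinearMap.mulRight F (AdjoinRoot.mk A h)) ∘ₗ (AdjoinRoot.mkₐ A).toLinearMap ∘ₗ
        (degreeLT F (n / 2)).subtype)
  have hfin : Module.Finite F (AdjoinRoot A) := Module.Finite.of_basis (AdjoinRoot.powerBasis hA).basis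
  have hdim : Module.finrank F (AdjoinRoot A) = n := by
    rw [(AdjoinRoot.powerBasis hA).finrank, AdjoinRoot.powerBasis_dim]
  have e1 := fun k : ℕ => (degreeLTEquiv F k)
  have hf : ∀ k, Module.Finite F (degreeLT F k) := fun k => Module.Finite.equiv (e1 k).symm
  have hd : ∀ k, Module.finrank F (degreeLT F k) = k := fun k => by
    rw [(e1 k).finrank_eq]; simp
  have := LinearMap.ker_ne_bot_of_finrank_lt (f := φ) (by
    rw [hdim, Module.finrank_prod, hd, hd]; omega)
  obtain ⟨⟨⟨U, hU⟩, ⟨V, hV⟩⟩, hmem, hne⟩ := (Submodule.ne_bot_iff _).1 this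
  refine ⟨U, V, ?_, ?_, ?_⟩
  · by_contra! hc
    exact hne (by simp [hc.1, hc.2])
  · rw [← AdjoinRoot.mk_eq_zero, map_add, map_mul]
    exact hmem
  · rw [mem_degreeLT] at hU hV
    have h1 : U.natDegree ≤ (n + 1) / 2 := by
      by_cases h0 : U = 0
      · simp [h0]
      · have := (natDegree_lt_iff_degree_lt h0).2 hU
        omega
    rw [poleOrder]
    split_ifs with h0
    · omega
    · have := (natDegree_lt_iff_degree_lt h0).2 hV
      omega

lemma exists_isMinRel {A : F[X]} (hA : A ≠ 0) (h : F[X]) : ∃ U V : F[X], IsMinRel A h U V := by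
  have hex : ∃ m : ℕ, ∃ U V : F[X], (U ≠ 0 ∨ V ≠ 0) ∧ A ∣ U + V * h ∧ poleOrder U V = m := by
    obtain ⟨U, V, h1, h2, -⟩ := exists_rel hA h
    exact ⟨_, U, V, h1, h2, rfl⟩
  obtain ⟨U, V, h1, h2, h3⟩ := Nat.find_spec hex
  refine ⟨U, V, h1, h2, fun U' V' h1' h2' => ?_⟩
  rw [h3]
  exact Nat.find_min' hex ⟨U', V', h1', h2', rfl⟩

lemma poleOrder_X_sub_C_mul_lt (x : F) {U V : F[X]} (h : U ≠ 0 ∨ V ≠ 0) :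
    poleOrder U V < poleOrder ((X - C x) * U) ((X - C x) * V) := by
  have hx := X_sub_C_ne_zero x
  have hd : ∀ p : F[X], p ≠ 0 → ((X - C x) * p).natDegree = p.natDegree + 1 := fun p hp => by
    rw [natDegree_mul hx hp, natDegree_X_sub_C, add_comm]
  simp only [poleOrder, mul_eq_zero, hx, false_or]
  split_ifs with hV
  · rw [hd U (by tauto)]; omega
  · rw [hd V hV]
    by_cases hU : U = 0
    · simp [hU]
    · rw [hd U hU]; omega

/-- The structure of the norm of a minimal relation. -/
lemma IsMinRel.polyR_eq (W : WeierstrassCurve F) {A h U V : F[X]} (hm : IsMinRel A h U V)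
    (hroot : ∀ x, ¬A.IsRoot x)
    (hW : A ∣ h ^ 2 + (C W.a₁ * X + C W.a₃) * h - (X ^ 3 + C W.a₂ * X ^ 2 + C W.a₄ * X + C W.a₆)) :
    ∃ S, polyR W U V = A * S ∧ S ≠ 0 ∧ S.natDegree ≤ 1 ∧
      poleOrder U V = A.natDegree + S.natDegree ∧
      ∀ x, S.IsRoot x → V.eval x ≠ 0 ∧ W.toAffine.Equation x (-U.eval x / V.eval x) := by
  have hA : A ≠ 0 := fun h0 => hroot 0 (by simp [h0])
  -- Modulo `A`, `U ≡ -V h`, so `R` becomes `-V²` times the Weierstrass equation at `y = h`, which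
  -- `A` divides.
  obtain ⟨S, hS⟩ : A ∣ polyR W U V := by
    obtain ⟨D, hD⟩ := hm.dvd
    obtain ⟨N, hN⟩ := hW
    refine ⟨-V ^ 2 * N + 2 * V * h * D + (C W.a₁ * X + C W.a₃) * V * D - A * D ^ 2, ?_⟩
    rw [polyR, eq_sub_of_add_eq hD]
    linear_combination (-V ^ 2) * hN
  have hR := polyR_ne_zero W hm.ne_zero
  have hS0 : S ≠ 0 := fun h0 => hR (by rw [hS, h0, mul_zero])
  have hdeg : poleOrder U V = A.natDegree + S.natDegree := by
    rw [← natDegree_polyR W hm.ne_zero, hS, natDegree_mul hA hS0]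
  refine ⟨S, hS, hS0, ?_, hdeg, fun x hx => ?_⟩
  · obtain ⟨U', V', h1, h2, h3⟩ := exists_rel hA h
    have := hm.poleOrder_le U' V' h1 h2
    omega
  have hR0 : (polyR W U V).eval x = 0 := by rw [hS, eval_mul, hx, mul_zero]
  -- If `V` vanished at `x`, so would `U`. Since `x` is not a root of `A`, the factor `X - x` could
  -- be removed from both, leaving a relation of smaller pole order.
  have hV : V.eval x ≠ 0 := by
    intro hV
    have hU : U.eval x = 0 := by
      simpa [polyR, hV] using hR0
    obtain ⟨U', rfl⟩ := dvd_iff_isRoot.2 hU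
    obtain ⟨V', rfl⟩ := dvd_iff_isRoot.2 hV
    have hne : U' ≠ 0 ∨ V' ≠ 0 := by
      rcases hm.ne_zero with h | h
      · exact Or.inl (right_ne_zero_of_mul h)
      · exact Or.inr (right_ne_zero_of_mul h)
    have hco : IsCoprime A (X - C x) :=
      ((irreducible_X_sub_C x).coprime_iff_not_dvd.2 fun hd => hroot x (dvd_iff_isRoot.1 hd)).symm
    have hd : A ∣ U' + V' * h := by
      refine hco.dvd_of_dvd_mul_left ?_
      have := hm.dvd
      rwa [mul_assoc, ← mul_add] at this
    exact absurd (hm.poleOrder_le _ _ hne hd) (not_le.2 (poleOrder_X_sub_C_mul_lt x hne))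
  refine ⟨hV, ?_⟩
  rw [Affine.equation_iff]
  simp only [polyR, eval_sub, eval_add, eval_mul, eval_pow, eval_X, eval_C] at hR0
  field_simp
  linear_combination -hR0

open WeierstrassCurve.Affine WeierstrassCurve.Affine.CoordinateRing in
lemma smul_basis_mem {W : Affine F} {I : Ideal W.CoordinateRing} {A h U V : F[X]}
    (hA : CoordinateRing.mk W (C A) ∈ I) (hh : CoordinateRing.mk W (Y - C h) ∈ I)
    (hd : A ∣ U + V * h) : U • (1 : W.CoordinateRing) + V • CoordinateRing.mk W Y ∈ I := by
  have h1 : U • (1 : W.CoordinateRing) + V • CoordinateRing.mk W Y =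
      CoordinateRing.mk W (C (U + V * h)) +
        CoordinateRing.mk W (C V) * CoordinateRing.mk W (Y - C h) := by
    simp only [CoordinateRing.smul, map_add, map_sub, map_mul]
    ring
  rw [h1]
  exact Ideal.add_mem _ (mk_C_mem_of_dvd hA hd) (Ideal.mul_mem_left _ _ hh)

section Extension

open WeierstrassCurve.Affine WeierstrassCurve.Affine.CoordinateRing

variable {L : Type u} [Field L] [Algebra F L] {W : WeierstrassCurve F} {W' : Affine L}
  {I : Ideal W'.CoordinateRing} {P : W'.Point} {A h U V S : F[X]}

lemma polyR_baseChange (hW : W' = W.map (algebraMap F L)) (hR : polyR W U V = A * S) :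
    Algebra.norm L[X] (U.map (algebraMap F L) • (1 : W'.CoordinateRing) +
      V.map (algebraMap F L) • CoordinateRing.mk W' Y) =
      -(A.map (algebraMap F L) * S.map (algebraMap F L)) := by
  rw [← Polynomial.map_mul, ← hR, ← polyR_map, ← hW, polyR_eq_neg_norm, neg_neg]

lemma smul_basis_map_ne_zero (hne : U ≠ 0 ∨ V ≠ 0) :
    U.map (algebraMap F L) • (1 : W'.CoordinateRing) +
      V.map (algebraMap F L) • CoordinateRing.mk W' Y ≠ 0 := by
  intro h0
  have h1 := smul_basis_eq_zero h0
  rw [Polynomial.map_eq_zero_iff (algebraMap F L).injective,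
    Polynomial.map_eq_zero_iff (algebraMap F L).injective] at h1
  tauto

lemma Represents.smul_basis_map_mem
    (hI : Represents I P (A.map (algebraMap F L)))
    (hh : CoordinateRing.mk W' (Y - C (h.map (algebraMap F L))) ∈ I) (hd : A ∣ U + V * h) :
    U.map (algebraMap F L) • (1 : W'.CoordinateRing) +
      V.map (algebraMap F L) • CoordinateRing.mk W' Y ∈ I := by
  refine smul_basis_mem hI.mk_C_mem hh ?_
  rw [← Polynomial.map_mul, ← Polynomial.map_add]
  exact Polynomial.map_dvd _ hd

lemma isUnit_map_of_natDegree (hS0 : S ≠ 0) (hS : S.natDegree = 0) :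
    IsUnit (S.map (algebraMap F L)) := by
  rw [Polynomial.isUnit_iff_degree_eq_zero, degree_map, degree_eq_natDegree hS0, hS]
  rfl

/-- The function `U + V y` lies in `I` and its norm is `A` up to a unit, so it generates `I`. -/
lemma Represents.point_eq_zero (hW : W' = W.map (algebraMap F L))
    (hI : Represents I P (A.map (algebraMap F L)))
    (hh : CoordinateRing.mk W' (Y - C (h.map (algebraMap F L))) ∈ I)
    (hne : U ≠ 0 ∨ V ≠ 0) (hd : A ∣ U + V * h) (hR : polyR W U V = A * S) (hS0 : S ≠ 0)
    (hS : S.natDegree = 0) : P = 0 := by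
  refine hI.eq_zero (Represents.smul_basis_map_mem hI hh hd) (smul_basis_map_ne_zero hne) ?_
  rw [polyR_baseChange hW hR]
  exact (associated_mul_unit_left _ _ (isUnit_map_of_natDegree hS0 hS)).neg_left

/-- The function `U + V y` also vanishes at the extra point. The ideal of that point is coprime to
`I` because `x` is not a root of `A`, so the function lies in the product of the two ideals, whose
norm `A (X - x)` is its own norm up to a unit. -/
lemma Represents.point_add_eq_zero (hW : W' = W.map (algebraMap F L))
    (hI : Represents I P (A.map (algebraMap F L)))
    (hh : CoordinateRing.mk W' (Y - C (h.map (algebraMap F L))) ∈ I)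
    (hne : U ≠ 0 ∨ V ≠ 0) (hd : A ∣ U + V * h) (hR : polyR W U V = A * S) (hS0 : S ≠ 0)
    (hS : S.natDegree ≤ 1) {x : F} (hx : S.IsRoot x) (hA : ¬A.IsRoot x) (hV : V.eval x ≠ 0)
    (hns : W'.Nonsingular (algebraMap F L x) (algebraMap F L (-U.eval x / V.eval x))) :
    P + .some _ _ hns = 0 := by
  have hJ := represents_XYIdeal hns
  have hco : IsCoprime I
      (XYIdeal W' (algebraMap F L x) (C (algebraMap F L (-U.eval x / V.eval x)))) := by
    have hcop : IsCoprime (X - C x) A :=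
      (irreducible_X_sub_C x).coprime_iff_not_dvd.2 fun hd => hA (dvd_iff_isRoot.1 hd)
    have hcop' := hcop.map (mapRingHom (algebraMap F L))
    simp only [coe_mapRingHom, Polynomial.map_sub, map_X, map_C] at hcop'
    exact isCoprime_of_mk_C_mem hI.mk_C_mem hJ.mk_C_mem hcop'.symm
  refine (hI.mul hJ).eq_zero (f := U.map (algebraMap F L) • (1 : W'.CoordinateRing) +
      V.map (algebraMap F L) • CoordinateRing.mk W' Y) ?_ (smul_basis_map_ne_zero hne) ?_
  · rw [Ideal.mul_eq_inf_of_isCoprime hco]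
    refine ⟨Represents.smul_basis_map_mem hI hh hd, ?_⟩
    refine smul_basis_mem (h := C (algebraMap F L (-U.eval x / V.eval x))) hJ.mk_C_mem
      (Ideal.subset_span (Or.inr rfl)) ?_
    rw [dvd_iff_isRoot, IsRoot.def, eval_add, eval_mul, eval_C, eval_map_apply, eval_map_apply,
      ← map_mul, ← map_add, mul_div_cancel₀ _ hV, add_neg_cancel, map_zero]
  · obtain ⟨D, hD⟩ := dvd_iff_isRoot.2 hx
    have hD0 : D ≠ 0 := right_ne_zero_of_mul (hD ▸ hS0)
    have hDdeg : D.natDegree = 0 := by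
      rw [hD, natDegree_mul (X_sub_C_ne_zero x) hD0, natDegree_X_sub_C] at hS
      omega
    rw [polyR_baseChange hW hR, hD, Polynomial.map_mul, ← mul_assoc, Polynomial.map_sub, map_X,
      map_C]
    exact (associated_mul_unit_left _ _ (isUnit_map_of_natDegree hD0 hDdeg)).neg_left

end Extension

end EllTrace

/-! ### Kernel vectors as functions, and the leftmost column -/

namespace EllTrace

variable {K : Type u} [Field K]

lemma poleOrder_le_iff {U V : K[X]} {m : ℕ} :
    poleOrder U V ≤ m ↔ (∀ j, m < 2 * j → U.coeff j = 0) ∧ ∀ j, m < 2 * j + 3 → V.coeff j = 0 := by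
  constructor
  · intro h
    rw [poleOrder] at h
    split_ifs at h with hV
    · exact ⟨fun j hj => coeff_eq_zero_of_natDegree_lt (by omega), fun j _ => by simp [hV]⟩
    · exact ⟨fun j hj => coeff_eq_zero_of_natDegree_lt (by omega),
        fun j hj => coeff_eq_zero_of_natDegree_lt (by omega)⟩
  · rintro ⟨h1, h2⟩
    have hU : 2 * U.natDegree ≤ m := by
      by_contra hc
      have := h1 U.natDegree (by omega)
      rw [coeff_natDegree, leadingCoeff_eq_zero] at this
      simp [this] at hc
    rw [poleOrder]
    split_ifs with hV
    · exact hU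
    · refine max_le hU ?_
      by_contra hc
      have := h2 V.natDegree (by omega)
      rw [coeff_natDegree, leadingCoeff_eq_zero] at this
      exact hV this

section Vector

variable {d : ℕ}

lemma entry_succ (z : Fin (d + 1) → K) {j : ℕ} (h : j < d + 1) :
    entry z (j + 1) = z ⟨j, h⟩ := by
  simp [entry, h]

lemma polyU_coeff_zero (z : Fin (d + 1) → K) : (polyU z).coeff 0 = z 0 := by
  rw [polyU, coeff_add, finsetSum_coeff, coeff_C_zero, Finset.sum_eq_zero, add_zero, entry_succ]
  · rfl
  · intro j hj
    have := Finset.mem_Icc.1 hj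
    rw [coeff_C_mul, coeff_X_pow, if_neg (by omega), mul_zero]

lemma polyU_coeff_succ (z : Fin (d + 1) → K) (j : ℕ) :
    (polyU z).coeff (j + 1) = if h : 2 * j + 1 < d + 1 then z ⟨2 * j + 1, h⟩ else 0 := by
  rw [polyU, coeff_add, finsetSum_coeff, coeff_C_succ, zero_add]
  simp only [coeff_C_mul, coeff_X_pow, mul_ite, mul_one, mul_zero, Finset.sum_ite_eq,
    Finset.mem_Icc]
  split_ifs with h1 h2 h2
  · exact entry_succ z h2
  · omega
  · omega
  · rfl

lemma polyV_coeff (hd : 2 ≤ d) (z : Fin (d + 1) → K) (j : ℕ) :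
    (polyV z).coeff j = if h : 2 * j + 2 < d + 1 then z ⟨2 * j + 2, h⟩ else 0 := by
  rw [polyV, finsetSum_coeff]
  simp only [coeff_C_mul, coeff_X_pow, mul_ite, mul_one, mul_zero, Finset.sum_ite_eq,
    Finset.mem_Icc]
  split_ifs with h1 h2 h2
  · exact entry_succ z h2
  · omega
  · omega
  · rfl

/-- Counting from `0`, the entry `i ≥ 1` is the coefficient of the monomial of pole order `i + 1`,
while entry `0` belongs to the constant `1`. The shift is uniform only for `m ≥ 1`, since pole order
`1` does not occur. -/
lemma poleOrder_poly_le_iff (hd : 2 ≤ d) (z : Fin (d + 1) → K) {m : ℕ} (hm : 1 ≤ m) :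
    poleOrder (polyU z) (polyV z) ≤ m ↔ ∀ i : Fin (d + 1), m ≤ i → z i = 0 := by
  rw [poleOrder_le_iff]
  constructor
  · rintro ⟨h1, h2⟩ ⟨i, hi⟩ hmi
    simp only at hmi
    rcases Nat.even_or_odd' i with ⟨k, rfl | rfl⟩
    · obtain ⟨j, rfl⟩ : ∃ j, k = j + 1 := ⟨k - 1, by omega⟩
      have := h2 j (by omega)
      rw [polyV_coeff hd, dif_pos (by omega)] at this
      exact this
    · have := h1 (k + 1) (by omega)
      rw [polyU_coeff_succ, dif_pos (by omega)] at this
      exact this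
  · intro h
    constructor
    · rintro (_ | j) hj
      · omega
      · rw [polyU_coeff_succ]
        split_ifs
        · exact h _ (by simp only; omega)
        · rfl
    · intro j hj
      rw [polyV_coeff hd]
      split_ifs
      · exact h _ (by simp only; omega)
      · rfl

lemma poleOrder_poly_le (hd : 2 ≤ d) (z : Fin (d + 1) → K) :
    poleOrder (polyU z) (polyV z) ≤ d + 1 :=
  (poleOrder_poly_le_iff hd z (by omega)).2 fun i hi => absurd i.2 (by omega)

lemma poly_ne_zero (hd : 2 ≤ d) {z : Fin (d + 1) → K} (hz : z ≠ 0) :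
    polyU z ≠ 0 ∨ polyV z ≠ 0 := by
  by_contra! hc
  refine hz (funext fun i => ?_)
  rcases Nat.eq_zero_or_pos i.1 with h0 | h0
  · have := polyU_coeff_zero z
    rw [hc.1, coeff_zero] at this
    rw [show i = 0 from Fin.ext h0, ← this]
    rfl
  · exact (poleOrder_poly_le_iff hd z le_rfl).1 (by simp [hc.1, hc.2, poleOrder]) i h0

lemma exists_vector (hd : 2 ≤ d) {U V : K[X]} (h : poleOrder U V ≤ d + 1) :
    ∃ z : Fin (d + 1) → K, polyU z = U ∧ polyV z = V := by
  obtain ⟨hU, hV⟩ := poleOrder_le_iff.1 h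
  refine ⟨fun i => if i.1 = 0 then U.coeff 0 else if i.1 % 2 = 1 then U.coeff ((i.1 + 1) / 2) else
    V.coeff ((i.1 - 2) / 2), ?_, ?_⟩
  · ext (_ | j)
    · rw [polyU_coeff_zero]; rfl
    · rw [polyU_coeff_succ]
      by_cases h1 : 2 * j + 1 < d + 1
      · rw [dif_pos h1, if_neg (by simp), if_pos (by simp only; omega)]
        congr 1
        simp only
        omega
      · rw [dif_neg h1]
        exact (hU _ (by omega)).symm
  · ext j
    rw [polyV_coeff hd]
    by_cases h1 : 2 * j + 2 < d + 1
    · rw [dif_pos h1, if_neg (by simp), if_neg (by simp only; omega)]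
      congr 1
      simp only
      omega
    · rw [dif_neg h1]
      exact (hV _ (by omega)).symm

/-- When `deg S = 1` the pole order is `deg A + 1`, so this identifies the integer `d_P` of the
algorithm with `deg A`. -/
lemma findGreatest_entry (hd : 2 ≤ d) {z : Fin (d + 1) → K} {n : ℕ} (hn : 1 ≤ n)
    (h : poleOrder (polyU z) (polyV z) = n + 1) :
    Nat.findGreatest (fun j => entry z (j + 1) ≠ 0) d = n := by
  have h1 := (poleOrder_poly_le_iff hd z (m := n + 1) (by omega)).1 h.le
  have h2 : ¬poleOrder (polyU z) (polyV z) ≤ n := by omega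
  rw [poleOrder_poly_le_iff hd z hn] at h2
  push Not at h2
  obtain ⟨i, hi, hzi⟩ := h2
  have hin : i.1 = n := by
    by_contra hne
    exact hzi (h1 i (by omega))
  rw [Nat.findGreatest_eq_iff]
  refine ⟨by omega, fun _ => ?_, fun k hk hkd => ?_⟩
  · rw [entry_succ z (by omega)]
    rwa [show (⟨n, by omega⟩ : Fin (d + 1)) = i from Fin.ext hin.symm]
  · rw [entry_succ z (by omega), not_not]
    exact h1 _ (by simp only; omega)

lemma sum_range_parity {M : Type*} [AddCommMonoid M] (g : ℕ → M) (d : ℕ) :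
    ∑ i ∈ Finset.range (d + 1), g i = g 0 + ∑ j ∈ Finset.range ((d + 1) / 2), g (2 * j + 1) +
      ∑ j ∈ Finset.range (d / 2), g (2 * j + 2) := by
  induction d with
  | zero => simp
  | succ d ih =>
    rw [Finset.sum_range_succ, ih]
    rcases Nat.even_or_odd' d with ⟨k, rfl | rfl⟩
    · rw [show (2 * k + 1 + 1) / 2 = k + 1 by omega, show (2 * k + 1) / 2 = k by omega,
        show 2 * k / 2 = k by omega, Finset.sum_range_succ _ k]
      abel
    · rw [show (2 * k + 1 + 1 + 1) / 2 = k + 1 by omega, show (2 * k + 1 + 1) / 2 = k + 1 by omega,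
        show (2 * k + 1) / 2 = k by omega, Finset.sum_range_succ (fun j => g (2 * j + 2)) k, ← add_assoc]

lemma aeval_poly {A : Type*} [CommRing A] [Algebra K A] (hd : 2 ≤ d) (z : Fin (d + 1) → K)
    (x y : A) :
    aeval x (polyU z) + aeval x (polyV z) * y = ∑ i : Fin (d + 1), z i •
      (if i.1 = 0 then 1 else if i.1 % 2 = 1 then x ^ ((i.1 + 1) / 2)
        else x ^ ((i.1 - 2) / 2) * y) := by
  let g : ℕ → A := fun i => entry z (i + 1) • (if i = 0 then 1 else if i % 2 = 1 then
    x ^ ((i + 1) / 2) else x ^ ((i - 2) / 2) * y)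
  have hg : ∀ i : Fin (d + 1), z i • (if i.1 = 0 then 1 else if i.1 % 2 = 1 then
      x ^ ((i.1 + 1) / 2) else x ^ ((i.1 - 2) / 2) * y) = g i := fun i => by
    simp only [g]
    rw [entry_succ z i.2]
  rw [Finset.sum_congr rfl fun i _ => hg i, Fin.sum_univ_eq_sum_range, sum_range_parity,
    polyU, polyV, map_add, map_sum, map_sum, aeval_C, Finset.sum_mul]
  congr 1
  · congr 1
    · simp [g, Algebra.smul_def]
    · rw [show Finset.Icc 1 ((d + 1) / 2) = Finset.Ico (0 + 1) ((d + 1) / 2 + 1) by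
          ext; simp only [Finset.mem_Icc, Finset.mem_Ico]; omega,
        ← Finset.sum_Ico_add', Finset.range_eq_Ico]
      refine Finset.sum_congr rfl fun j _ => ?_
      simp only [g]
      rw [if_neg (by omega), if_pos (by omega), map_mul, aeval_C, map_pow, aeval_X,
        Algebra.smul_def]
      congr 2
      omega
  · rw [show Finset.Icc 0 ((d - 2) / 2) = Finset.range (d / 2) by ext; simp only [Finset.mem_Icc, Finset.mem_range]; omega]
    refine Finset.sum_congr rfl fun j _ => ?_
    simp only [g]
    rw [if_neg (by omega), if_neg (by omega), map_mul, aeval_C, map_pow, aeval_X,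
        Algebra.smul_def, mul_assoc]
    simp

end Vector

lemma bottomZeros_lt {n : ℕ} {v : Fin n → K} (hv : v ≠ 0) : bottomZeros v < n := by
  by_contra hc
  rw [not_lt, le_bottomZeros_iff v le_rfl] at hc
  exact hv (funext fun i => hc i (by omega))

lemma bottomZeros_eq {n : ℕ} {v : Fin n → K} (hv : v ≠ 0) : 
    ∃ i : Fin n, n ≤ i + (bottomZeros v + 1) ∧ v i ≠ 0 := by
  have h : ¬bottomZeros v + 1 ≤ bottomZeros v := by omega
  rw [le_bottomZeros_iff v (bottomZeros_lt hv)] at h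
  push Not at h
  exact h

/-- In a nonzero combination, let `J` be the last column with nonzero coefficient. All other columns
involved have more bottom zeros, so the lowest nonzero entry of column `J` survives; column `J` in
turn has at most as many bottom zeros as the leftmost one. -/
lemma _root_.IsEchelonKernel.bottomZeros_le {m n r : ℕ} {M : Matrix (Fin m) (Fin n) K}
    {Z : Matrix (Fin n) (Fin r) K} (hZ : IsEchelonKernel M Z) (hr : 0 < r) {w : Fin n → K}
    (hw : w ∈ LinearMap.ker M.mulVecLin) (hw0 : w ≠ 0) :
    bottomZeros w ≤ bottomZeros (Z.col ⟨0, hr⟩) := by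
  rw [← hZ.span_eq, Submodule.mem_span_range_iff_exists_fun] at hw
  obtain ⟨c, rfl⟩ := hw
  have hne : (Finset.univ.filter fun j => c j ≠ 0).Nonempty := by
    by_contra hc
    rw [Finset.not_nonempty_iff_eq_empty, Finset.filter_eq_empty_iff] at hc
    refine hw0 (Finset.sum_eq_zero fun j _ => ?_)
    rw [not_not.1 (hc (Finset.mem_univ j)), zero_smul]
  obtain ⟨J, hJ, hmax⟩ := Finset.exists_max_image _ id hne
  have hcJ : c J ≠ 0 := (Finset.mem_filter.1 hJ).2
  have hZJ : Z.col J ≠ 0 := hZ.linearIndependent.ne_zero J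
  obtain ⟨i, hi, hne⟩ := bottomZeros_eq hZJ
  refine le_trans ?_ (hZ.strictAnti.antitone (show (⟨0, hr⟩ : Fin r) ≤ J from Nat.zero_le _))
  by_contra hlt
  rw [not_le, ← Nat.succ_le_iff, Nat.succ_eq_add_one,
    le_bottomZeros_iff _ (bottomZeros_lt hZJ)] at hlt
  have h0 := hlt i hi
  rw [Finset.sum_apply, Finset.sum_eq_single J] at h0
  · exact (mul_ne_zero hcJ hne) h0
  · intro j _ hjJ
    by_cases hcj : c j = 0
    · simp [hcj]
    · have hj : j < J := lt_of_le_of_ne (hmax j (by simp [hcj])) hjJ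
      have := (le_bottomZeros_iff (Z.col j) (bottomZeros_lt hZJ)).1
        (Nat.succ_le_iff.2 (hZ.strictAnti hj)) i hi
      rw [Pi.smul_apply, this, smul_zero]
  · simp

section ValueMatrix

variable {T xP yP : K[X]}

lemma valueList_degree_lt (hT : 1 ≤ T.natDegree) (hx : xP.degree < T.degree)
    (hy : yP.degree < T.degree) : ∀ j, (valueList T xP yP j).degree < T.degree
  | 0 => by
    simp only [valueList, degree_zero]
    rw [bot_lt_iff_ne_bot, degree_ne_bot]
    rintro rfl
    simp at hT
  | 1 => by
    simp only [valueList, degree_one]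
    exact natDegree_pos_iff_degree_pos.1 hT
  | 2 => hx
  | 3 => hy
  | (j + 4) => by
    simp only [valueList]
    exact EuclideanDomain.mod_lt _ (ne_zero_of_natDegree_gt hT)

lemma mk_valueList : ∀ i, AdjoinRoot.mk T (valueList T xP yP (i + 1)) =
    if i = 0 then 1 else if i % 2 = 1 then AdjoinRoot.mk T xP ^ ((i + 1) / 2)
        else AdjoinRoot.mk T xP ^ ((i - 2) / 2) * AdjoinRoot.mk T yP
  | 0 => by simp [valueList]
  | 1 => by simp [valueList]
  | 2 => by simp [valueList]
  | (i + 3) => by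
    have h := mk_valueList (i + 1)
    simp only [valueList]
    have hmod : AdjoinRoot.mk T ((xP * valueList T xP yP (i + 2)) % T) =
        AdjoinRoot.mk T (xP * valueList T xP yP (i + 2)) := by
      rw [AdjoinRoot.mk_eq_mk]
      exact ⟨-(xP * valueList T xP yP (i + 2) / T), by
        linear_combination EuclideanDomain.mod_add_div (xP * valueList T xP yP (i + 2)) T⟩
    rw [hmod, map_mul, show i + 2 = i + 1 + 1 from rfl, h, if_neg (Nat.succ_ne_zero i),
      if_neg (Nat.succ_ne_zero (i + 2))]
    by_cases hi : (i + 1) % 2 = 1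
    · rw [if_pos hi, if_pos (by omega), ← pow_succ']
      congr 1
      omega
    · rw [if_neg hi, if_neg (by omega), ← mul_assoc, ← pow_succ']
      congr 2
      omega

/-- The columns are coefficient vectors of representatives of degree `< deg T`, so a combination of
them vanishes exactly when its class in `K[t]/T(t)` does. -/
lemma mem_ker_valueMatrix (hd : 2 ≤ T.natDegree) (hx : xP.degree < T.degree)
    (hy : yP.degree < T.degree) (z : Fin (T.natDegree + 1) → K) :
    z ∈ LinearMap.ker (valueMatrix T xP yP).mulVecLin ↔
      aeval (AdjoinRoot.mk T xP) (polyU z) +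
        aeval (AdjoinRoot.mk T xP) (polyV z) * AdjoinRoot.mk T yP = 0 := by
  have hT0 : T ≠ 0 := by rintro rfl; simp at hd
  set p : K[X] := ∑ i : Fin (T.natDegree + 1), z i • valueList T xP yP (i + 1) with hp
  have hpdeg : p.degree < T.degree := by
    rw [degree_eq_natDegree hT0, ← mem_degreeLT]
    refine Submodule.sum_mem _ fun i _ => Submodule.smul_mem _ _ ?_
    rw [mem_degreeLT, ← degree_eq_natDegree hT0]
    exact valueList_degree_lt (by omega) hx hy _
  have hmk : aeval (AdjoinRoot.mk T xP) (polyU z) +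
        aeval (AdjoinRoot.mk T xP) (polyV z) * AdjoinRoot.mk T yP = AdjoinRoot.mk T p := by
    rw [aeval_poly hd, hp, map_sum]
    refine Finset.sum_congr rfl fun i _ => ?_
    rw [← mk_valueList, AdjoinRoot.smul_mk]
  rw [hmk, AdjoinRoot.mk_eq_zero, LinearMap.mem_ker]
  have hcoeff : ∀ i : Fin T.natDegree, (valueMatrix T xP yP).mulVecLin z i = p.coeff i := by
    intro i
    rw [Matrix.mulVecLin_apply, Matrix.mulVec, dotProduct, hp, finsetSum_coeff]
    refine Finset.sum_congr rfl fun j _ => ?_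
    rw [coeff_smul, smul_eq_mul, mul_comm]
    rfl
  constructor
  · intro h
    suffices p = 0 by simp [this]
    ext i
    rw [coeff_zero]
    by_cases hi : i < T.natDegree
    · rw [← hcoeff ⟨i, hi⟩, h]; rfl
    · refine coeff_eq_zero_of_degree_lt (hpdeg.trans_le ?_)
      rw [degree_eq_natDegree hT0]
      exact_mod_cast not_lt.1 hi
  · intro h
    have := eq_zero_of_dvd_of_degree_lt h hpdeg
    ext i
    rw [hcoeff, this]
    simp

lemma numCols_pos (ker : KernelRoutine K) (T xP yP : K[X]) :
    0 < ker.numCols (valueMatrix T xP yP) := by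
  have h1 : LinearMap.ker (valueMatrix T xP yP).mulVecLin ≠ ⊥ :=
    LinearMap.ker_ne_bot_of_finrank_lt (by simp)
  rw [← (ker.isEchelonKernel _).span_eq] at h1
  by_contra hc
  have : IsEmpty (Fin (ker.numCols (valueMatrix T xP yP))) := by
    rw [Nat.eq_zero_of_not_pos hc]; infer_instance
  simp at h1

/-- The leftmost column of the kernel matrix is a relation of minimal pole order. -/
lemma leftmost_column (ker : KernelRoutine K) (hd : 2 ≤ T.natDegree) (hx : xP.degree < T.degree)
    (hy : yP.degree < T.degree) (hr : 0 < ker.numCols (valueMatrix T xP yP))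
    {z : Fin (T.natDegree + 1) → K} (hz : z = (ker.mat (valueMatrix T xP yP)).col ⟨0, hr⟩) :
    (polyU z ≠ 0 ∨ polyV z ≠ 0) ∧ aeval (AdjoinRoot.mk T xP) (polyU z) +
        aeval (AdjoinRoot.mk T xP) (polyV z) * AdjoinRoot.mk T yP = 0 ∧
      ∀ U V : K[X], (U ≠ 0 ∨ V ≠ 0) → aeval (AdjoinRoot.mk T xP) U +
        aeval (AdjoinRoot.mk T xP) V * AdjoinRoot.mk T yP = 0 →
        poleOrder (polyU z) (polyV z) ≤ poleOrder U V := by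
  have hZ := ker.isEchelonKernel (valueMatrix T xP yP)
  have hz0 : z ≠ 0 := hz ▸ hZ.linearIndependent.ne_zero _
  refine ⟨poly_ne_zero hd hz0, ?_, fun U V hne hUV => ?_⟩
  · rw [← mem_ker_valueMatrix hd hx hy, ← hZ.span_eq, hz]
    exact Submodule.subset_span ⟨_, rfl⟩
  by_cases hle : poleOrder U V ≤ T.natDegree + 1
  · obtain ⟨w, rfl, rfl⟩ := exists_vector hd hle
    have hw0 : w ≠ 0 := by
      rintro rfl
      simp [polyU, polyV, entry] at hne
    have hb := hZ.bottomZeros_le hr ((mem_ker_valueMatrix hd hx hy w).2 hUV) hw0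
    rw [← hz] at hb
    -- The comparison of entries needs `m ≥ 1`. If the pole order of `w` is `0`, it only bounds that
    -- of `z` by `1`, and `hne1` excludes the value `1`.
    set m := max 1 (poleOrder (polyU w) (polyV w)) with hm
    have hwm := (poleOrder_poly_le_iff hd w (m := m) (le_max_left _ _)).1 (le_max_right _ _)
    have hle1 : T.natDegree + 1 - m ≤ bottomZeros z :=
      le_trans ((le_bottomZeros_iff w (by omega)).2 fun i hi => hwm i (by omega)) hb
    rw [le_bottomZeros_iff z (by omega)] at hle1
    have hle2 := (poleOrder_poly_le_iff hd z (m := m) (le_max_left _ _)).2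
      fun i hi => hle1 i (by omega)
    have hne1 : poleOrder (polyU z) (polyV z) ≠ 1 := by
      rw [poleOrder]
      split_ifs <;> omega
    omega
  · exact (poleOrder_poly_le hd z).trans (by omega)

end ValueMatrix

end EllTrace

/-! ### Sums over embeddings of a separable extension -/

namespace EllTrace

open scoped Polynomial.Bivariate

section Embeddings

variable {N M Ω : Type u} [Field N] [Field M] [Field Ω] [Algebra N M] [Algebra N Ω]
  [FiniteDimensional N M] [Algebra.IsSeparable N M] [IsAlgClosed Ω]

/-- Embeddings of `N⟮a⟯` correspond to the roots of the minimal polynomial of `a`, and by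
separability each extends to `M` in `[M : N⟮a⟯]` ways. -/
lemma sum_algHom_apply {Γ : Type*} [AddCommMonoid Γ] (a : M) (φ : Ω → Γ) :
    ∑ j : M →ₐ[N] Ω, φ (j a) =
      Module.finrank N⟮a⟯ M • ∑ r ∈ ((minpoly N a).aroots Ω).toFinset, φ r := by
  have ha : IsIntegral N a := Algebra.IsSeparable.isIntegral N a
  have hsum : ∑ σ : N⟮a⟯ →ₐ[N] Ω, φ (σ (AdjoinSimple.gen N a)) =
      ∑ r ∈ ((minpoly N a).aroots Ω).toFinset, φ r := by
    rw [Finset.sum_subtype (p := fun r => r ∈ (minpoly N a).aroots Ω) _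
      (fun r => Multiset.mem_toFinset)]
    refine Fintype.sum_equiv (algHomAdjoinIntegralEquiv N ha) _ _ fun σ => ?_
    obtain ⟨r, rfl⟩ := (algHomAdjoinIntegralEquiv N (K := Ω) ha).symm.surjective σ
    rw [algHomAdjoinIntegralEquiv_symm_apply_gen, Equiv.apply_symm_apply]
  rw [← hsum, Fintype.sum_equiv algHomEquivSigma (fun σ : M →ₐ[N] Ω => _)
    fun σ => φ (σ.1 (AdjoinSimple.gen N a)), ← Finset.univ_sigma_univ, Finset.sum_sigma,
    ← Finset.sum_nsmul]
  · refine Finset.sum_congr rfl fun σ _ => ?_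
    let : Algebra N⟮a⟯ Ω := σ.toRingHom.toAlgebra
    simp_rw [Finset.sum_const, Finset.card_univ, ← AlgHom.card N⟮a⟯ M Ω]
  · intro σ
    simp only [algHomEquivSigma, Equiv.coe_fn_mk, AlgHom.domRestrict, AlgHom.comp_apply,
      IsScalarTower.coe_toAlgHom']
    rfl

/-- The point `(x, y)` of `W`, or `0` if there is no such point. -/
noncomputable def pointOrZero {F : Type u} [Field F] (W : Affine F) (x y : F) : W.Point :=
  if h : W.Nonsingular x y then .some x y h else 0

lemma pointOrZero_eq {F : Type u} [Field F] {W : Affine F} {x y : F} (h : W.Nonsingular x y) :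
    pointOrZero W x y = .some x y h := dif_pos h

/-- The conjugates of a point over its `x`-coordinate cancel when the `y`-coordinate is not
rational over the field of the `x`-coordinate. -/
lemma sum_pointOrZero_eq_zero {W : WeierstrassCurve N} {WM : Affine M}
    (hWM : WM = W.map (algebraMap N M)) {W' : Affine Ω} (hW : W' = W.map (algebraMap N Ω))
    {x : N} {y : M} (h : WM.Equation (algebraMap N M x) y)
    (hy : y ∉ (algebraMap N M).range) :
    ∑ j : M →ₐ[N] Ω, pointOrZero W' (algebraMap N Ω x) (j y) = 0 := by
  rw [sum_algHom_apply y (pointOrZero W' (algebraMap N Ω x))]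
  have hyi : IsIntegral N y := Algebra.IsSeparable.isIntegral N y
  -- `Q` is the Weierstrass equation in `y` over the fixed `x`; as `y` is not in `N`, it is the
  -- minimal polynomial of `y`.
  set Q : N[X] := X ^ 2 + C (W.a₁ * x + W.a₃) * X -
    C (x ^ 3 + W.a₂ * x ^ 2 + W.a₄ * x + W.a₆) with hQ
  have hQ' : Q = X ^ 2 + (C (W.a₁ * x + W.a₃) * X -
    C (x ^ 3 + W.a₂ * x ^ 2 + W.a₄ * x + W.a₆)) := by rw [hQ, add_sub_assoc]
  have hlow : (C (W.a₁ * x + W.a₃) * X -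
    C (x ^ 3 + W.a₂ * x ^ 2 + W.a₄ * x + W.a₆)).degree < 2 := by
    rw [sub_eq_add_neg, ← C_neg]
    exact degree_linear_lt
  have hmonic : Q.Monic := hQ' ▸ monic_X_pow_add hlow
  have hdeg : Q.natDegree = 2 := by
    rw [hQ']
    refine natDegree_eq_of_degree_eq_some ?_
    rw [degree_add_eq_left_of_degree_lt (by rwa [degree_X_pow]), degree_X_pow]
  have hQy : aeval y Q = 0 := by
    subst hWM
    rw [Affine.equation_iff] at h
    simp only [hQ, map_add, map_sub, map_mul, map_pow, aeval_X, aeval_C]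
    simp only [map_a₁, map_a₂, map_a₃, map_a₄, map_a₆] at h
    linear_combination h
  have hmin : minpoly N y = Q := by
    refine (eq_of_monic_of_dvd_of_natDegree_le (minpoly.monic hyi) hmonic (minpoly.dvd N y hQy) ?_).symm
    rw [hdeg]
    exact (minpoly.two_le_natDegree_iff hyi).2 hy
  have hsep : Q.Separable := hmin ▸ Algebra.IsSeparable.isSeparable N y
  have hmem : ∀ r, r ∈ (Q.aroots Ω).toFinset ↔ W'.Equation (algebraMap N Ω x) r := by
    intro r
    subst hW
    rw [Multiset.mem_toFinset, mem_aroots, and_iff_right hmonic.ne_zero, Affine.equation_iff, hQ]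
    simp only [map_add, map_sub, map_mul, map_pow, aeval_X, aeval_C, map_a₁, map_a₂, map_a₃, map_a₄,
      map_a₆]
    constructor <;> intro h <;> linear_combination h
  rw [hmin]
  convert nsmul_zero _
  -- Negation pairs the roots of `Q`. A root fixed by negation would be a zero of `Q' = 2Y + a₁x +
  -- a₃`, contradicting separability.
  refine Finset.sum_involution (fun r _ => W'.negY (algebraMap N Ω x) r) ?_ ?_ ?_ ?_
  · intro r hr
    by_cases hns : W'.Nonsingular (algebraMap N Ω x) r
    · rw [pointOrZero_eq hns, pointOrZero_eq ((Affine.nonsingular_neg ..).2 hns)]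
      exact Affine.Point.add_of_Y_eq rfl (Affine.negY_negY ..).symm
    · rw [pointOrZero, dif_neg hns, pointOrZero, dif_neg, add_zero]
      rwa [Affine.nonsingular_neg]
  · intro r hr _ hneg
    have h1 := hsep.aeval_derivative_ne_zero (x := r)
      (by simpa [hmonic.ne_zero] using hr)
    apply h1
    subst hW
    rw [Affine.negY] at hneg
    have hder : derivative Q = C 2 * X + C (W.a₁ * x + W.a₃) := by
      rw [hQ, derivative_sub, derivative_add, derivative_C_mul, derivative_C, derivative_X_sq,
        derivative_X, mul_one, sub_zero]
    rw [hder, map_add, map_mul, aeval_C, aeval_C, aeval_X, map_add, map_mul, map_ofNat]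
    simp only [map_a₁, map_a₃] at hneg
    linear_combination -hneg
  · intro r hr
    rw [hmem] at hr ⊢
    exact (Affine.equation_neg ..).2 hr
  · intro r hr
    exact Affine.negY_negY ..

end Embeddings

section Point

variable {K : Type u} [Field K] {E : WeierstrassCurve K} [E.IsElliptic]

lemma map_point_mk {L L' : Type u} [Field L] [Field L'] [Algebra K L] [Algebra K L']
    (j : L →ₐ[K] L') {x y : L}
    (h : (E⁄L).toAffine.Equation x y) (h' : (E⁄L').toAffine.Nonsingular (j x) (j y)) :
    Affine.Point.map j (Affine.Point.mk h) = .some (j x) (j y) h' := rfl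

lemma map_point_mk_eq_pointOrZero {L L' : Type u} [Field L] [Field L'] [Algebra K L]
    [Algebra K L'] (j : L →ₐ[K] L') {x y : L}
    (h : (E⁄L).toAffine.Equation x y) :
    Affine.Point.map j (Affine.Point.mk h) = pointOrZero (E⁄L').toAffine (j x) (j y) := by
  have h' : (E⁄L').toAffine.Nonsingular (j x) (j y) :=
    Affine.equation_iff_nonsingular.1 ((Affine.baseChange_equation _ j.injective x y).2 h)
  rw [pointOrZero_eq h', map_point_mk]

end Point

section Trace

variable {K M Ω : Type u} [Field K] [Field M] [Field Ω] [Algebra K M] [Algebra K Ω]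
  [FiniteDimensional K M] [Algebra.IsSeparable K M] [IsAlgClosed Ω] {E : WeierstrassCurve K}
  [E.IsElliptic]

lemma sum_map_eq_zero {x y : M} (h : (E⁄M).toAffine.Equation x y) (hy : y ∉ K⟮x⟯) :
    ∑ j : M →ₐ[K] Ω, Affine.Point.map j (Affine.Point.mk h) = 0 := by
  rw [Fintype.sum_equiv (algHomEquivSigma (B := K⟮x⟯)) _
    (fun σ => pointOrZero (E⁄Ω).toAffine (σ.1 (AdjoinSimple.gen K x)) (σ.2 y)),
    ← Finset.univ_sigma_univ, Finset.sum_sigma]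
  · refine Finset.sum_eq_zero fun σ _ => ?_
    let : Algebra K⟮x⟯ Ω := σ.toRingHom.toAlgebra
    refine sum_pointOrZero_eq_zero (W := E⁄K⟮x⟯) (WM := (E⁄M).toAffine)
      (Affine.map_baseChange E (K⟮x⟯.val)).symm (Affine.map_baseChange E σ).symm 
      (x := AdjoinSimple.gen K x) (y := y) ?_ ?_
    · exact h
    · rintro ⟨z, rfl⟩
      exact hy z.2
  · intro j
    rw [map_point_mk_eq_pointOrZero]
    rfl

/-- `s` is the sum of the points `(r, g(r))` over the roots `r` of the minimal polynomial, and `I`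
is the product of their ideals. By separability the roots are distinct: the norm of `I` is then the
minimal polynomial itself, and `I` is an intersection, so `Y - g` can be tested at one point at a
time. -/
lemma exists_represents {x y : M} (h : (E⁄M).toAffine.Equation x y) {g : K[X]}
    (hg : aeval x g = y) :
    ∃ (s : (E⁄Ω).toAffine.Point) (I : Ideal (E⁄Ω).toAffine.CoordinateRing),
      Affine.CoordinateRing.Represents I s ((minpoly K x).map (algebraMap K Ω)) ∧
      Affine.CoordinateRing.mk (E⁄Ω).toAffine (Y - C (g.map (algebraMap K Ω))) ∈ I ∧
      ∑ j : M →ₐ[K] Ω, Affine.Point.map j (Affine.Point.mk h) = Module.finrank K⟮x⟯ M • s := by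
  have hxi : IsIntegral K x := Algebra.IsSeparable.isIntegral K x
  set W := (E⁄Ω).toAffine with hWdef
  set R := ((minpoly K x).aroots Ω).toFinset with hR
  have hns : ∀ r ∈ R, W.Nonsingular r (aeval r g) := by
    intro r hr
    rw [hR, Multiset.mem_toFinset, mem_aroots] at hr
    obtain ⟨j, hj⟩ : ∃ j : K⟮x⟯ →ₐ[K] Ω, j (AdjoinSimple.gen K x) = r :=
      ⟨_, algHomAdjoinIntegralEquiv_symm_apply_gen K hxi ⟨r, mem_aroots.2 hr⟩⟩
    have h1 : (E⁄K⟮x⟯).toAffine.Equation (AdjoinSimple.gen K x) (aeval (AdjoinSimple.gen K x) g) := by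
      rw [← Affine.baseChange_equation _ (K⟮x⟯.val).injective, ← aeval_algHom_apply]
      rw [← hg] at h
      exact h
    have h2 := (Affine.baseChange_equation _ j.injective _ _).2 h1
    rw [← aeval_algHom_apply, hj] at h2
    exact Affine.equation_iff_nonsingular.1 h2
  refine ⟨∑ r ∈ R, pointOrZero W r (aeval r g),
    ∏ r ∈ R, Affine.CoordinateRing.XYIdeal W r (C (aeval r g)), ?_, ?_, ?_⟩
  · have hprod : (minpoly K x).map (algebraMap K Ω) = ∏ r ∈ R, (X - C r) := by
      have hsep : ((minpoly K x).map (algebraMap K Ω)).Separable :=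
        Polynomial.Separable.map (Algebra.IsSeparable.isSeparable K x)
      have hnd : ((minpoly K x).aroots Ω).Nodup := nodup_roots hsep
      rw [Finset.prod, hR, Multiset.toFinset_val, Multiset.dedup_eq_self.2 hnd]
      exact (IsAlgClosed.splits _).eq_prod_roots_of_monic ((minpoly.monic hxi).map _)
    rw [hprod]
    refine Affine.CoordinateRing.Represents.prod R fun r hr => ?_
    rw [pointOrZero_eq (hns r hr)]
    exact Affine.CoordinateRing.represents_XYIdeal (hns r hr)
  · rw [Ideal.prod_eq_iInf_of_pairwise_isCoprime]
    · simp only [Ideal.mem_iInf]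
      intro r _
      have := Affine.CoordinateRing.mk_Y_sub_C_mem_XYIdeal (W := W) r (g.map (algebraMap K Ω))
      rwa [eval_map_algebraMap] at this
    · intro r _ r' _ hne
      exact Affine.CoordinateRing.isCoprime_of_mk_C_mem
        (Affine.CoordinateRing.mk_C_mem_XYIdeal r _) (Affine.CoordinateRing.mk_C_mem_XYIdeal r' _)
        (pairwise_coprime_X_sub_C Function.injective_id hne)
  · rw [← sum_algHom_apply x (fun r => pointOrZero W r (aeval r g))]
    refine Finset.sum_congr rfl fun j _ => ?_
    rw [map_point_mk_eq_pointOrZero, ← hg, aeval_algHom_apply]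

end Trace

end EllTrace

/-! ### Correctness of the separable algorithm -/

namespace EllTrace

variable {K : Type u} [Field K] {E : WeierstrassCurve K}

lemma mem_adjoin_simple_iff_exists_aeval {M : Type u} [Field M] [Algebra K M] {x y : M}
    (hx : IsIntegral K x) : y ∈ K⟮x⟯ ↔ ∃ g : K[X], aeval x g = y := by
  rw [← mem_toSubalgebra, adjoin_simple_toSubalgebra_of_isAlgebraic hx.isAlgebraic,
    Algebra.adjoin_singleton_eq_range_aeval]
  rfl

lemma equation_baseChange_self {x y : K} (h : E.toAffine.Equation x y) :
    (E⁄K).toAffine.Equation x y :=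
  h.map (algebraMap K K)

variable [E.IsElliptic]

section Column

variable {T xP : K[X]} {z : Fin (T.natDegree + 1) → K}

lemma ellTraceSepOfColumn_of_polyV_eq_zero (h : polyV z = 0) :
    ellTraceSepOfColumn E T xP z = some 0 := by
  simp [ellTraceSepOfColumn, h]

lemma ellTraceSepOfColumn_of_natDegree_eq_zero {S : K[X]}
    (hm : minpoly K (AdjoinRoot.mk T xP) ≠ 0)
    (hR : polyR E (polyU z) (polyV z) = minpoly K (AdjoinRoot.mk T xP) * S) (hS0 : S ≠ 0)
    (hS : S.natDegree = 0) : ellTraceSepOfColumn E T xP z = some 0 := by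
  have hR0 : minpoly K (AdjoinRoot.mk T xP) ∣ polyR E (polyU z) (polyV z) := ⟨S, hR⟩
  unfold ellTraceSepOfColumn
  -- The algorithm may already stop at `V = 0`; both exits return `O`.
  by_cases hV : polyV z = 0
  · simp [hV]
  · have hdiv : polyR E (polyU z) (polyV z) / minpoly K (AdjoinRoot.mk T xP) = S := by
      rw [hR, mul_div_cancel_left₀ _ hm]
    have hSdeg : S.degree = 0 := by rw [degree_eq_natDegree hS0, hS]; rfl
    simp only [hV, hR0, hdiv, hSdeg, if_false, if_true, not_true]

lemma ellTraceSepOfColumn_of_natDegree_eq_one {S : K[X]} {n : ℕ}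
    (hm : minpoly K (AdjoinRoot.mk T xP) ≠ 0)
    (hR : polyR E (polyU z) (polyV z) = minpoly K (AdjoinRoot.mk T xP) * S)
    (hS : S.natDegree = 1) (hroot : ∀ x, S.IsRoot x → (polyV z).eval x ≠ 0 ∧
      E.toAffine.Equation x (-(polyU z).eval x / (polyV z).eval x))
    (hn : Nat.findGreatest (fun j => entry z (j + 1) ≠ 0) T.natDegree = n)
    (hnd : n ∣ T.natDegree) :
    ∃ (x : K) (hx : S.IsRoot x),
      ellTraceSepOfColumn E T xP z = some ((-((T.natDegree / n : ℕ) : ℤ)) •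
        (Affine.Point.mk (equation_baseChange_self (hroot x hx).2) : (E⁄K).toAffine.Point)) := by
  have hS0 : S ≠ 0 := by rintro rfl; simp at hS
  have hR0 : minpoly K (AdjoinRoot.mk T xP) ∣ polyR E (polyU z) (polyV z) := ⟨S, hR⟩
  have hdiv : polyR E (polyU z) (polyV z) / minpoly K (AdjoinRoot.mk T xP) = S := by
    rw [hR, mul_div_cancel_left₀ _ hm]
  have hex : ∃! x, S.IsRoot x := by
    have hSd : S.degree = 1 := by rw [degree_eq_natDegree hS0, hS]; rfl
    obtain ⟨x, hx⟩ := exists_root_of_degree_eq_one hSd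
    refine ⟨x, hx, fun y hy => ?_⟩
    have hcard := card_roots' S
    by_contra hne
    have h2 : ({x, y} : Finset K) ⊆ S.roots.toFinset := by
      intro w hw
      rw [Multiset.mem_toFinset, mem_roots hS0]
      rcases Finset.mem_insert.1 hw with rfl | hw
      · exact hx
      · rwa [Finset.mem_singleton.1 hw]
    have h3 := (Finset.card_le_card h2).trans (Multiset.toFinset_card_le _)
    rw [Finset.card_pair (Ne.symm hne)] at h3
    omega
  have hV : polyV z ≠ 0 := fun h0 => (hroot _ hex.choose_spec.1).1 (by simp [h0])
  have hSdeg : ¬S.degree = 0 := by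
    rw [degree_eq_natDegree hS0, hS]
    exact one_ne_zero
  refine ⟨hex.choose, hex.choose_spec.1, ?_⟩
  unfold ellTraceSepOfColumn
  simp only [hV, hR0, hdiv, hSdeg, hn, hnd, if_false, if_true, not_true, dif_pos hex,
    (hroot _ hex.choose_spec.1).1, dif_pos (equation_baseChange_self (hroot _ hex.choose_spec.1).2)]

end Column

section Correctness

variable {S : K[X]} [hSi : Fact (Irreducible S)]

lemma adjoinRoot_isSeparable (hS : S.Separable) : Algebra.IsSeparable K (AdjoinRoot S) := by
  have h1 : IsSeparable K (AdjoinRoot.root S) :=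
    hS.of_dvd (minpoly.dvd K _ (by rw [AdjoinRoot.aeval_eq, AdjoinRoot.mk_self]))
  have h2 := (isSeparable_adjoin_simple_iff_isSeparable K _).2 h1
  rw [adjoin_root_eq_top S] at h2
  exact (isSeparable_top K _).1 h2

lemma finrank_adjoinRoot : Module.finrank K (AdjoinRoot S) = S.natDegree := by
  rw [(AdjoinRoot.powerBasis hSi.out.ne_zero).finrank, AdjoinRoot.powerBasis_dim]

lemma eq_C_of_mk_eq {p : K[X]} (hp : p.degree < S.degree) {a : K}
    (h : AdjoinRoot.mk S p = algebraMap K (AdjoinRoot S) a) : p = C a := by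
  rw [AdjoinRoot.algebraMap_eq, ← AdjoinRoot.mk_C, AdjoinRoot.mk_eq_mk] at h
  refine sub_eq_zero.1 (eq_zero_of_dvd_of_degree_lt h ?_)
  refine (degree_sub_le _ _).trans_lt (max_lt hp (degree_C_le.trans_lt ?_))
  exact natDegree_pos_iff_degree_pos.1 hSi.out.natDegree_pos

theorem ellTraceSep_correct (ker : KernelRoutine K) (hS : S.Separable) {xP yP : K[X]}
    (hx : xP.degree < S.degree) (hy : yP.degree < S.degree)
    {x y : AdjoinRoot S} (hxP : AdjoinRoot.mk S xP = x) (hyP : AdjoinRoot.mk S yP = y)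
    (h : (E⁄(AdjoinRoot S)).toAffine.Equation x y) :
    ∃ R : (E⁄K).toAffine.Point, ellTraceSep ker E S xP yP = some R ∧
      ∀ (Ω : Type u) [Field Ω] [IsAlgClosed Ω] [Algebra K Ω],
        Affine.Point.map (Algebra.ofId K Ω) R =
          ∑ j : AdjoinRoot S →ₐ[K] Ω, Affine.Point.map j (Affine.Point.mk h) := by
  have hsep := adjoinRoot_isSeparable hS
  subst hxP hyP
  by_cases hxc : xP.natDegree = 0
  · by_cases hyc : yP.natDegree = 0
    · have hxa : AdjoinRoot.mk S xP = algebraMap K _ (xP.coeff 0) := by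
        conv_lhs => rw [eq_C_of_natDegree_eq_zero hxc, AdjoinRoot.mk_C, ← AdjoinRoot.algebraMap_eq]
      have hya : AdjoinRoot.mk S yP = algebraMap K _ (yP.coeff 0) := by
        conv_lhs => rw [eq_C_of_natDegree_eq_zero hyc, AdjoinRoot.mk_C, ← AdjoinRoot.algebraMap_eq]
      have h0 : (E⁄K).toAffine.Equation (xP.coeff 0) (yP.coeff 0) := by
        rw [← Affine.baseChange_equation E (Algebra.ofId K (AdjoinRoot S)).injective,
          Algebra.ofId_apply, Algebra.ofId_apply, ← hxa, ← hya]
        exact h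
      refine ⟨S.natDegree • Affine.Point.mk h0, ?_, ?_⟩
      · simp only [ellTraceSep, hxc, hyc, if_true, dif_pos h0]
      · intro Ω _ _ _
        have hj : ∀ j : AdjoinRoot S →ₐ[K] Ω, Affine.Point.map j (Affine.Point.mk h) =
            Affine.Point.map (Algebra.ofId K Ω) (Affine.Point.mk h0) := by
          intro j
          rw [map_point_mk_eq_pointOrZero, map_point_mk_eq_pointOrZero, hxa, hya, j.commutes,
            j.commutes, Algebra.ofId_apply, Algebra.ofId_apply]
        rw [Finset.sum_congr rfl fun j _ => hj j, Finset.sum_const, Finset.card_univ, AlgHom.card,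
          finrank_adjoinRoot, map_nsmul]
    · refine ⟨0, ?_, ?_⟩
      · simp only [ellTraceSep, hxc, hyc, if_true, if_false]
      · intro Ω _ _ _
        rw [map_zero, sum_map_eq_zero h]
        intro hmem
        rw [eq_C_of_natDegree_eq_zero hxc, AdjoinRoot.mk_C, ← AdjoinRoot.algebraMap_eq,
          adjoin_simple_eq_bot_iff.2 (IntermediateField.algebraMap_mem _ _), mem_bot] at hmem
        obtain ⟨b, hb⟩ := hmem
        have := eq_C_of_mk_eq hy hb.symm
        exact hyc (by rw [this, natDegree_C])
  -- A nonconstant `x_P` of degree `< deg S` forces this; it makes the truncated `(d - 2) / 2` in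
  -- `polyV` harmless.
  have hd : 2 ≤ S.natDegree := by
    have h0 : xP ≠ 0 := by rintro rfl; simp at hxc
    have := natDegree_lt_natDegree h0 hx
    omega
  have hr := numCols_pos ker S xP yP
  set z := (ker.mat (valueMatrix S xP yP)).col ⟨0, hr⟩ with hz
  obtain ⟨hne, hrel, hmin⟩ := leftmost_column ker hd hx hy hr hz
  have halg : ellTraceSep ker E S xP yP = ellTraceSepOfColumn E S xP z := by
    simp only [ellTraceSep, hxc, if_false, dif_pos hr, hz]
  rw [halg]
  have hxi : IsIntegral K (AdjoinRoot.mk S xP) := Algebra.IsSeparable.isIntegral K _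
  have hxK : AdjoinRoot.mk S xP ∉ (algebraMap K (AdjoinRoot S)).range := by
    rintro ⟨a, ha⟩
    exact hxc (by rw [eq_C_of_mk_eq hx ha.symm, natDegree_C])
  have htower : (minpoly K (AdjoinRoot.mk S xP)).natDegree *
      Module.finrank K⟮AdjoinRoot.mk S xP⟯ (AdjoinRoot S) = S.natDegree := by
    rw [← adjoin.finrank hxi, Module.finrank_mul_finrank, finrank_adjoinRoot]
  by_cases hyx : AdjoinRoot.mk S yP ∈ K⟮AdjoinRoot.mk S xP⟯
  · obtain ⟨g, hg⟩ : ∃ g : K[X], aeval (AdjoinRoot.mk S xP) g = AdjoinRoot.mk S yP :=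
      (mem_adjoin_simple_iff_exists_aeval hxi).1 hyx
    have hmr : IsMinRel (minpoly K (AdjoinRoot.mk S xP)) g (polyU z) (polyV z) := by
      refine ⟨hne, minpoly.dvd K _ (by rw [map_add, map_mul, hg, hrel]), fun U V hUV hdvd => ?_⟩
      refine hmin U V hUV ?_
      obtain ⟨D, hD⟩ := hdvd
      rw [← hg, ← map_mul, ← map_add, hD, map_mul, minpoly.aeval, zero_mul]
    -- The minimal polynomial of `x` has no root in `K` because `x ∉ K`.
    obtain ⟨S', hR, hS0, hS1, hord, hroot⟩ := hmr.polyR_eq E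
      (fun a ha => hxK ⟨a, minpoly.root hxi ha⟩) (minpoly.dvd K _ (by
        have h := (Affine.equation_iff (W := E.map (algebraMap K (AdjoinRoot S))) _ _).1 h
        simp only [map_a₁, map_a₂, map_a₃, map_a₄, map_a₆] at h
        simp only [map_sub, map_add, map_mul, map_pow, aeval_X, aeval_C, hg]
        linear_combination h))
    have hrep := fun (Ω : Type u) [Field Ω] [IsAlgClosed Ω] [Algebra K Ω] =>
      exists_represents (Ω := Ω) h (g := g) hg
    rcases Nat.le_one_iff_eq_zero_or_eq_one.1 hS1 with hSd | hSd
    · refine ⟨0, ellTraceSepOfColumn_of_natDegree_eq_zero (minpoly.ne_zero hxi) hR hS0 hSd, fun Ω _ _ _ => ?_⟩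
      obtain ⟨s, I, hI, hgI, hsum⟩ := hrep Ω
      have hs : s = 0 := Represents.point_eq_zero (W := E) rfl hI hgI hne hmr.dvd hR hS0 hSd
      rw [hsum, map_zero, hs, nsmul_zero]
    · have hn1 : 1 ≤ (minpoly K (AdjoinRoot.mk S xP)).natDegree := minpoly.natDegree_pos hxi
      obtain ⟨a, ha, hres⟩ := ellTraceSepOfColumn_of_natDegree_eq_one (minpoly.ne_zero hxi) hR hSd
        hroot (findGreatest_entry hd hn1 (by rw [hord, hSd])) ⟨_, htower.symm⟩
      refine ⟨_, hres, fun Ω _ _ _ => ?_⟩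
      obtain ⟨s, I, hI, hgI, hsum⟩ := hrep Ω
      have hns := Affine.equation_iff_nonsingular.1 ((Affine.baseChange_equation E
        (Algebra.ofId K Ω).injective _ _).2 (equation_baseChange_self (hroot a ha).2))
      have hs : s + (.some _ _ hns : (E⁄Ω).toAffine.Point) = 0 := Represents.point_add_eq_zero (W := E) rfl hI hgI hne hmr.dvd hR hS0 hS1 ha
        (fun hA => hxK ⟨a, minpoly.root hxi hA⟩) (hroot a ha).1 hns
      have hdiv : S.natDegree / (minpoly K (AdjoinRoot.mk S xP)).natDegree =
          Module.finrank K⟮AdjoinRoot.mk S xP⟯ (AdjoinRoot S) := by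
        rw [← htower, Nat.mul_div_cancel_left _ hn1]
      rw [hsum, map_zsmul, map_point_mk _ _ hns, eq_neg_of_add_eq_zero_left hs, neg_smul,
        hdiv, smul_neg, natCast_zsmul]
  · refine ⟨0, ellTraceSepOfColumn_of_polyV_eq_zero ?_, fun Ω _ _ _ => ?_⟩
    · by_contra hV
      -- The minimal polynomial of `x` is itself a relation with `V = 0`. Minimality then gives `2
      -- deg V + 3 ≤ 2 deg A`, so `V(x) ≠ 0` and `y = -U(x) / V(x)` would lie in `K(x)`.
      have hle := hmin (minpoly K (AdjoinRoot.mk S xP)) 0 (Or.inl (minpoly.ne_zero hxi))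
        (by rw [minpoly.aeval, map_zero, zero_mul, add_zero])
      rw [poleOrder, poleOrder, if_neg hV, if_pos rfl] at hle
      have hVx : aeval (AdjoinRoot.mk S xP) (polyV z) ≠ 0 := by
        intro h0
        have := natDegree_le_of_dvd (minpoly.dvd K _ h0) hV
        omega
      apply hyx
      have : AdjoinRoot.mk S yP = -aeval (AdjoinRoot.mk S xP) (polyU z) /
          aeval (AdjoinRoot.mk S xP) (polyV z) := by
        rw [eq_div_iff hVx]
        linear_combination hrel
      rw [this]
      have hmem : ∀ p : K[X], aeval (AdjoinRoot.mk S xP) p ∈ K⟮AdjoinRoot.mk S xP⟯ := fun p =>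
        (mem_adjoin_simple_iff_exists_aeval hxi).2 ⟨p, rfl⟩
      exact div_mem (neg_mem (hmem _)) (hmem _)
    · rw [map_zero, sum_map_eq_zero h hyx]

end Correctness

end EllTrace

/-! ### Rationality of multiples in purely inseparable extensions -/

namespace EllTrace

open scoped Polynomial.Bivariate

section PowerOfY

variable {F L : Type u} [Field F] [Field L] [Algebra F L] {W : WeierstrassCurve F} {W' : Affine L}

lemma exists_mk_Y_pow (hW : W' = W.map (algebraMap F L)) (q : ℕ) :
    ∃ α β : F[X], Affine.CoordinateRing.mk W' (Y ^ q) = Affine.CoordinateRing.mk W'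
      (C (α.map (algebraMap F L)) + C (β.map (algebraMap F L)) * Y) := by
  obtain ⟨α, β, h⟩ := Affine.CoordinateRing.exists_smul_basis_eq
    (Affine.CoordinateRing.mk W.toAffine (Y ^ q))
  refine ⟨α, β, ?_⟩
  rw [Affine.CoordinateRing.smul, Affine.CoordinateRing.smul, mul_one, ← map_mul, ← map_add,
    AdjoinRoot.mk_eq_mk] at h
  have h' := Polynomial.map_dvd (mapRingHom (algebraMap F L)) h
  have hp : W'.polynomial = W.toAffine.polynomial.map (mapRingHom (algebraMap F L)) := by
    rw [hW]
    exact Affine.map_polynomial _ _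
  rw [← hp] at h'
  refine (AdjoinRoot.mk_eq_mk.2 ?_).symm
  simpa using h'

lemma evalEval_eq_of_mk_eq {p r : L[X][Y]}
    (h : Affine.CoordinateRing.mk W' p = Affine.CoordinateRing.mk W' r) {x y : L}
    (hxy : W'.Equation x y) : p.evalEval x y = r.evalEval x y := by
  obtain ⟨D, hD⟩ := AdjoinRoot.mk_eq_mk.1 h
  have h2 := congrArg (evalEval x y) hD
  rw [evalEval_sub, evalEval_mul, hxy, zero_mul] at h2
  exact sub_eq_zero.1 h2

/-- The coordinates of a point of order two are separable in characteristic different from two. -/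
lemma mem_range_of_eq_negY [IsPurelyInseparable F L] (hW : W' = W.map (algebraMap F L))
    (h2 : (2 : L) ≠ 0) {x y : L} (h : W'.Nonsingular x y) (hy : y = W'.negY x y) :
    x ∈ (algebraMap F L).range ∧ y ∈ (algebraMap F L).range := by
  have hy' : 2 * y + (algebraMap F L W.a₁ * x + algebraMap F L W.a₃) = 0 := by
    subst hW
    rw [Affine.negY] at hy
    simp only [map_a₁, map_a₃] at hy
    linear_combination hy
  obtain ⟨heq, hns⟩ := (Affine.nonsingular_iff ..).1 h
  have hx : x ∈ (algebraMap F L).range := by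
    -- The 2-division polynomial. Nonsingularity makes `x` a simple root, so `x` is separable over
    -- `F` and hence in `F`.
    let Ψ : F[X] := C 4 * X ^ 3 + C W.b₂ * X ^ 2 + C (2 * W.b₄) * X + C W.b₆
    have hΨ : aeval x Ψ = 0 := by
      subst hW
      rw [Affine.equation_iff] at heq
      simp only [map_a₁, map_a₃, map_a₂, map_a₄, map_a₆] at heq
      simp only [Ψ, map_add, map_mul, map_pow, aeval_X, aeval_C, b₂, b₄, b₆, map_ofNat]
      linear_combination (2 * y + (algebraMap F L W.a₁ * x + algebraMap F L W.a₃)) * hy' - 4 * heq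
    have hder : aeval x (derivative Ψ) ≠ 0 := by
      subst hW
      rcases hns with hns | hns
      · simp only [map_a₁, map_a₂, map_a₄] at hns
        have hd : derivative Ψ = C 4 * (C 3 * X ^ 2) + C W.b₂ * (C 2 * X) + C (2 * W.b₄) := by
          simp only [Ψ, derivative_add, derivative_C_mul, derivative_X_pow, derivative_C,
            derivative_X, Nat.cast_ofNat, Nat.reduceSub, pow_one, mul_one, add_zero]
        rw [hd]
        simp only [map_add, map_mul, map_pow, aeval_X, aeval_C, b₂, b₄, map_ofNat]
        intro h0
        apply hns
        have h4 : (4 : L) ≠ 0 := by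
          rw [show (4 : L) = 2 * 2 by norm_num]
          exact mul_ne_zero h2 h2
        apply mul_left_cancel₀ h4
        linear_combination 2 * algebraMap F L W.a₁ * hy' - h0
      · exfalso
        rw [Affine.negY] at hy
        exact hns hy
    have hsep : IsSeparable F x := by
      have hxi : IsIntegral F x := IsPurelyInseparable.isIntegral' F x
      rw [IsSeparable, separable_iff_derivative_ne_zero (minpoly.irreducible hxi)]
      intro h0
      obtain ⟨D, hD⟩ := minpoly.dvd F x hΨ
      apply hder
      rw [hD, derivative_mul, h0, zero_mul, zero_add, map_mul, minpoly.aeval, zero_mul]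
    exact IsPurelyInseparable.inseparable F x hsep
  refine ⟨hx, ?_⟩
  obtain ⟨x0, rfl⟩ := hx
  refine ⟨-(W.a₁ * x0 + W.a₃) / 2, ?_⟩
  rw [map_div₀, map_neg, map_add, map_mul, map_ofNat]
  field_simp
  linear_combination -hy'

end PowerOfY

section Rational

variable {K F L : Type u} [Field K] [Field F] [Field L] [Algebra K F] [Algebra K L] [Algebra F L]
  [IsScalarTower K F L] {E : WeierstrassCurve K}

lemma baseChange_eq_map :
    (E⁄L).toAffine = (E⁄F).map (algebraMap F L) :=
  (Affine.map_baseChange E (IsScalarTower.toAlgHom K F L)).symm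

lemma some_mem_range {x y : F}
    (h : (E⁄L).toAffine.Nonsingular (algebraMap F L x) (algebraMap F L y)) :
    Affine.Point.some _ _ h ∈
      (Affine.Point.map (W' := E) (IsScalarTower.toAlgHom K F L)).range :=
  ⟨.some x y ((Affine.baseChange_nonsingular E (IsScalarTower.toAlgHom K F L).injective x y).1 h),
    rfl⟩

/-- In a purely inseparable extension of height at most `d`, multiplication by `p ^ d` takes values
in the rational points. -/
theorem pow_nsmul_mem_range [(E⁄L).toAffine.IsElliptic] {p d : ℕ} [hp : Fact p.Prime] [CharP F p]
    (hd : d ≠ 0) (hq : ∀ a : L, a ^ p ^ d ∈ (algebraMap F L).range) (P : (E⁄L).toAffine.Point) :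
    p ^ d • P ∈ (Affine.Point.map (W' := E) (IsScalarTower.toAlgHom K F L)).range := by
  have : CharP L p := charP_of_injective_algebraMap (algebraMap F L).injective p
  have hpi : IsPurelyInseparable F L :=
    (isPurelyInseparable_iff_pow_mem F p).2 fun a => ⟨d, hq a⟩
  have hW := baseChange_eq_map (K := K) (F := F) (L := L) (E := E)
  rcases P with _ | ⟨x, y, hns⟩
  · exact (smul_zero (p ^ d) : p ^ d • (0 : (E⁄L).toAffine.Point) = 0) ▸ zero_mem _
  by_cases hrat : x ∈ (algebraMap F L).range ∧ y ∈ (algebraMap F L).range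
  · obtain ⟨⟨x, rfl⟩, ⟨y, rfl⟩⟩ := hrat
    exact nsmul_mem (some_mem_range hns) _
  by_cases hy : y = (E⁄L).toAffine.negY x y
  · by_cases h2 : (2 : L) = 0
    · have hp2 : p = 2 := by
        have : p ∣ 2 := (CharP.cast_eq_zero_iff L p 2).1 (by exact_mod_cast h2)
        exact (Nat.prime_dvd_prime_iff_eq hp.out Nat.prime_two).1 this
      obtain ⟨k, rfl⟩ := Nat.exists_eq_succ_of_ne_zero hd
      have h0 : 2 • (Affine.Point.some x y hns : (E⁄L).toAffine.Point) = 0 := by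
        rw [two_nsmul]
        exact Affine.Point.add_self_of_Y_eq hy
      rw [hp2, pow_succ, mul_nsmul', h0, nsmul_zero]
      exact zero_mem _
    · exact absurd (mem_range_of_eq_negY hW h2 hns hy) hrat
  obtain ⟨α, β, hαβ⟩ := exists_mk_Y_pow hW (p ^ d)
  have hev : y ^ p ^ d = aeval x α + aeval x β * y := by
    simpa [evalEval] using evalEval_eq_of_mk_eq hαβ hns.1
  have hevn : (E⁄L).toAffine.negY x y ^ p ^ d =
      aeval x α + aeval x β * (E⁄L).toAffine.negY x y := by
    simpa [evalEval] using evalEval_eq_of_mk_eq hαβ ((Affine.equation_neg ..).2 hns.1)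
  -- The same `α`, `β` serve for `y` and for its conjugate `negY`; if `β(x) = 0` their `q`-th powers
  -- would agree, hence they would too.
  have hβ : aeval x β ≠ 0 := by
    intro h0
    rw [h0, zero_mul, add_zero] at hev hevn
    apply hy
    rw [← sub_eq_zero, ← pow_eq_zero_iff (pow_ne_zero d hp.out.ne_zero), sub_pow_char_pow, hev,
      hevn, sub_self]
  obtain ⟨a, ha⟩ := hq x
  obtain ⟨c, hc⟩ := hq y
  -- Defined over `F`, and equal to `(X - x) ^ q` over `L`, the norm of the `q`-th power of the
  -- ideal of `P`.
  set A : F[X] := X ^ p ^ d - C a with hA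
  have hAmap : A.map (algebraMap F L) = (X - C x) ^ p ^ d := by
    rw [hA, Polynomial.map_sub, Polynomial.map_pow, map_X, map_C, ha, sub_pow_char_pow, C_pow]
  -- The only possible root is `x`; if `x ∈ F`, then `y ^ q = α(x) + β(x) y` would put `y` in `F` as
  -- well.
  have hroot : ∀ r, ¬A.IsRoot r := by
    intro r hr
    have hxr : algebraMap F L r = x := by
      have h1 : (A.map (algebraMap F L)).eval (algebraMap F L r) = 0 := by
        rw [eval_map_apply, hr, map_zero]
      rw [hAmap, eval_pow, eval_sub, eval_X, eval_C] at h1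
      exact sub_eq_zero.1 (pow_eq_zero_iff (pow_ne_zero d hp.out.ne_zero)|>.1 h1)
    refine hrat ⟨⟨r, hxr⟩, ⟨(c - α.eval r) / β.eval r, ?_⟩⟩
    subst hxr
    rw [aeval_algebraMap_apply_eq_algebraMap_eval] at hβ hev
    rw [aeval_algebraMap_apply_eq_algebraMap_eval] at hev
    rw [map_div₀, map_sub, hc, hev, add_sub_cancel_left, mul_div_cancel_left₀ _ hβ]
  obtain ⟨u, b, hub⟩ : IsCoprime A β := by
    rw [← Polynomial.isCoprime_map (algebraMap F L), hAmap]
    refine IsCoprime.pow_left ((irreducible_X_sub_C x).coprime_iff_not_dvd.2 fun hdvd => hβ ?_)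
    rwa [dvd_iff_isRoot, IsRoot.def, eval_map_algebraMap] at hdvd
  -- Modulo `I`, `Y ^ q` is the constant `c = y ^ q`. Solving `c ≡ α + β Y` with the inverse `b` of
  -- `β` modulo `A` gives a polynomial `h` over `F` with `Y ≡ h`.
  set h : F[X] := b * (C c - α) with hh
  have hI := (Affine.CoordinateRing.represents_XYIdeal hns).pow (p ^ d)
  set I := Affine.CoordinateRing.XYIdeal (E⁄L).toAffine x (C y) ^ p ^ d with hIdef
  rw [← hAmap] at hI
  have hhI : Affine.CoordinateRing.mk (E⁄L).toAffine (Y - C (h.map (algebraMap F L))) ∈ I := by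
    have hub' := congrArg (Polynomial.map (algebraMap F L)) hub
    rw [Polynomial.map_add, Polynomial.map_mul, Polynomial.map_mul, Polynomial.map_one] at hub'
    have hY : Affine.CoordinateRing.mk (E⁄L).toAffine (Y ^ p ^ d - C (C (y ^ p ^ d))) ∈ I := by
      rw [C_pow, C_pow, ← sub_pow_char_pow, map_pow]
      refine Ideal.pow_mem_pow ?_ _
      simpa using Affine.CoordinateRing.mk_Y_sub_C_mem_XYIdeal (W := (E⁄L).toAffine) x (C y)
    have hid : Y - C (h.map (algebraMap F L)) = C (b.map (algebraMap F L)) *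
        ((C (α.map (algebraMap F L)) + C (β.map (algebraMap F L)) * Y) - C (C (y ^ p ^ d))) +
        C (u.map (algebraMap F L)) * Y * C (A.map (algebraMap F L)) := by
      rw [hh, Polynomial.map_mul, Polynomial.map_sub, map_C, hc]
      simp only [C_mul, C_sub]
      have := congrArg (fun r : L[X] => (C r : Polynomial (Polynomial L))) hub'
      simp only [C_mul, C_add, C_1] at this
      linear_combination -(Y : Polynomial (Polynomial L)) * this
    rw [hid, map_add, map_mul, map_sub, ← hαβ, ← map_sub, map_mul]
    exact Ideal.add_mem _ (Ideal.mul_mem_left _ _ hY) (Ideal.mul_mem_left _ _ hI.mk_C_mem)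
  -- The left side is, over `L`, the norm of `Y - h ∈ I`, and so divisible by the norm of `I`.
  have hAW : A ∣ h ^ 2 + (C (E⁄F).a₁ * X + C (E⁄F).a₃) * h -
      (X ^ 3 + C (E⁄F).a₂ * X ^ 2 + C (E⁄F).a₄ * X + C (E⁄F).a₆) := by
    have hmem := smul_basis_mem (U := -h.map (algebraMap F L)) (V := 1) hI.mk_C_mem hhI
      (by rw [one_mul, neg_add_cancel]; exact dvd_zero _)
    have hdvd := hI.norm_dvd hmem
    rw [Affine.CoordinateRing.norm_smul_basis, hW] at hdvd
    rw [← Polynomial.map_dvd_map' (algebraMap F L)]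
    convert hdvd using 1
    simp only [Polynomial.map_sub, Polynomial.map_add, Polynomial.map_mul, Polynomial.map_pow,
      map_X, map_C, map_a₁, map_a₂, map_a₃, map_a₄, map_a₆]
    ring
  have hA0 : A ≠ 0 := fun h0 => hroot 0 (by simp [h0])
  obtain ⟨U, V, hm⟩ := exists_isMinRel hA0 h
  obtain ⟨S, hR, hS0, hS1, -, hSroot⟩ := hm.polyR_eq (E⁄F) hroot hAW
  rcases Nat.le_one_iff_eq_zero_or_eq_one.1 hS1 with hSd | hSd
  · rw [Represents.point_eq_zero hW hI hhI hm.ne_zero hm.dvd hR hS0 hSd]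
    exact zero_mem _
  · obtain ⟨x0, hx0⟩ := exists_root_of_degree_eq_one (p := S)
      (by rw [degree_eq_natDegree hS0, hSd]; rfl)
    obtain ⟨hV, heq⟩ := hSroot x0 hx0
    have hns0 : (E⁄L).toAffine.Nonsingular (algebraMap F L x0)
        (algebraMap F L (-U.eval x0 / V.eval x0)) :=
      Affine.equation_iff_nonsingular.1
        ((Affine.baseChange_equation E (IsScalarTower.toAlgHom K F L).injective _ _).2 heq)
    rw [eq_neg_of_add_eq_zero_left (Represents.point_add_eq_zero hW hI hhI hm.ne_zero hm.dvd hR hS0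
      hS1 hx0 (hroot x0) hV hns0)]
    exact neg_mem (some_mem_range hns0)

end Rational

end EllTrace

/-! ### Coordinates, and basic properties of the trace -/

namespace EllTrace

section Coordinates

variable {K L : Type u} [Field K] [Field L] [Algebra K L] {E : WeierstrassCurve K} [E.IsElliptic]
  {S : K[X]} [hSi : Fact (Irreducible S)]

lemma hasCoords_map_iff {L' : Type u} [Field L'] [Algebra K L'] (φ : L →ₐ[K] L') {θ : L}
    {Q : (E⁄L).toAffine.Point} {f : K[X] × K[X]} :
    HasCoords E (φ θ) (Affine.Point.map φ Q) f ↔ HasCoords E θ Q f := by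
  have hmk {x y : L} (h : (E⁄L).toAffine.Equation x y) (h') :
      Affine.Point.map φ (Affine.Point.mk h) =
        (Affine.Point.mk (x := φ x) (y := φ y) h' : (E⁄L').toAffine.Point) := rfl
  have heq := Affine.baseChange_equation E φ.injective (aeval θ f.1) (aeval θ f.2)
  unfold HasCoords
  simp only [aeval_algHom_apply]
  constructor
  · rintro ⟨h, hQ⟩
    refine ⟨heq.1 h, Affine.Point.map_injective φ ?_⟩
    rw [hQ, hmk]
  · rintro ⟨h, rfl⟩
    exact ⟨heq.2 h, hmk h _⟩

lemma exists_degree_lt_mk_eq (x : AdjoinRoot S) :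
    ∃ p : K[X], p.degree < S.degree ∧ AdjoinRoot.mk S p = x := by
  induction x using AdjoinRoot.induction_on with
  | _ p =>
    refine ⟨p % S, EuclideanDomain.mod_lt p hSi.out.ne_zero, ?_⟩
    rw [AdjoinRoot.mk_eq_mk]
    exact ⟨-(p / S), by linear_combination EuclideanDomain.mod_add_div p S⟩

lemma eq_of_mk_eq {S p q : K[X]} (hp : p.degree < S.degree) (hq : q.degree < S.degree)
    (h : AdjoinRoot.mk S p = AdjoinRoot.mk S q) : p = q := by
  rw [AdjoinRoot.mk_eq_mk] at h
  exact sub_eq_zero.1 (eq_zero_of_dvd_of_degree_lt h ((degree_sub_le p q).trans_lt (max_lt hp hq)))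

lemma exists_hasCoords_iff {Q : (E⁄(AdjoinRoot S)).toAffine.Point} (hQ : Q ≠ 0) :
    ∃ f : K[X] × K[X], ∀ g : K[X] × K[X],
      (g.1.degree < S.degree ∧ g.2.degree < S.degree ∧ HasCoords E (AdjoinRoot.root S) Q g) ↔
        g = f := by
  rcases Q with _ | ⟨x, y, h⟩
  · exact absurd rfl hQ
  obtain ⟨p, hp, rfl⟩ := exists_degree_lt_mk_eq x
  obtain ⟨q, hq, rfl⟩ := exists_degree_lt_mk_eq y
  refine ⟨(p, q), fun g => ⟨?_, ?_⟩⟩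
  · rintro ⟨h1, h2, hg, h3⟩
    obtain ⟨h4, h5⟩ := (Affine.Point.some.injEq ..).mp h3
    rw [AdjoinRoot.aeval_eq] at h4 h5
    exact Prod.ext (eq_of_mk_eq h1 hp h4.symm) (eq_of_mk_eq h2 hq h5.symm)
  · rintro rfl
    refine ⟨hp, hq, ?_, ?_⟩
    · rw [AdjoinRoot.aeval_eq, AdjoinRoot.aeval_eq]
      exact h.1
    · simp only [Affine.Point.mk, AdjoinRoot.aeval_eq]

theorem exists_trace (ker : KernelRoutine K) (hS : S.Separable)
    (Q : (E⁄(AdjoinRoot S)).toAffine.Point) :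
    ∃ R : (E⁄K).toAffine.Point,
      (∀ (Ω : Type u) [Field Ω] [IsAlgClosed Ω] [Algebra K Ω],
        Affine.Point.map (Algebra.ofId K Ω) R =
          ∑ j : AdjoinRoot S →ₐ[K] Ω, Affine.Point.map j Q) ∧
      ∀ f : K[X] × K[X], f.1.degree < S.degree → f.2.degree < S.degree →
        HasCoords E (AdjoinRoot.root S) Q f → ellTraceSep ker E S f.1 f.2 = some R := by
  by_cases hQ : Q = 0
  · subst hQ
    refine ⟨0, ?_, ?_⟩
    · intro Ω _ _ _
      simp only [map_zero, Finset.sum_const_zero]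
    · rintro f - - ⟨h, h0⟩
      exact absurd h0.symm (Affine.Point.some_ne_zero _)
  · obtain ⟨f, hf⟩ := exists_hasCoords_iff hQ
    obtain ⟨h1, h2, h3, rfl⟩ := (hf f).2 rfl
    obtain ⟨R, hR, hRt⟩ := ellTraceSep_correct ker hS h1 h2 (AdjoinRoot.aeval_eq _).symm
      (AdjoinRoot.aeval_eq _).symm h3
    refine ⟨R, hRt, fun g hg1 hg2 hg => ?_⟩
    rw [(hf g).1 ⟨hg1, hg2, hg⟩, hR]

end Coordinates

section PurelyInseparable

variable {K F L : Type u} [Field K] [Field F] [Field L] [Algebra K F] [Algebra K L] [Algebra F L]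
  [IsScalarTower K F L]

lemma bijective_comp_toAlgHom [IsPurelyInseparable F L] (Ω : Type u) [Field Ω] [IsAlgClosed Ω]
    [Algebra K Ω] :
    Function.Bijective fun j : L →ₐ[K] Ω => j.comp (IsScalarTower.toAlgHom K F L) := by
  obtain ⟨hinj, hsurj⟩ := IsPurelyInseparable.bijective_comp_algebraMap F L Ω
  constructor
  · intro j j' h
    apply AlgHom.coe_ringHom_injective
    apply hinj
    ext x
    exact DFunLike.congr_fun h x
  · intro i
    obtain ⟨j, hj⟩ := hsurj (i : F →+* Ω)
    have hj' (x : F) : j (algebraMap F L x) = i x := DFunLike.congr_fun hj x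
    refine ⟨{ j with commutes' := fun r => ?_ }, AlgHom.ext hj'⟩
    change j (algebraMap K L r) = _
    rw [IsScalarTower.algebraMap_apply K F L, hj', AlgHom.commutes]

variable {E : WeierstrassCurve K}

/-- Over the base field `K` the condition on `j` is vacuous: every `K`-algebra map extends the
structure map, which is the only choice of `i`. -/
lemma isTrace_iff [FiniteDimensional K L] {P : (E⁄L).toAffine.Point} {R : (E⁄K).toAffine.Point} :
    IsTrace E P R ↔ ∀ (Ω : Type u) [Field Ω] [IsAlgClosed Ω] [Algebra K Ω],
      Affine.Point.map (Algebra.ofId K Ω) R =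
        Field.finInsepDegree K L • ∑ j : L →ₐ[K] Ω, Affine.Point.map j P := by
  have key (Ω : Type u) [Field Ω] [IsAlgClosed Ω] [Algebra K Ω] (i : K →ₐ[K] Ω) :
      ∑ᶠ j : {j : L →ₐ[K] Ω // ∀ x : K, j (algebraMap K L x) = i x}, Affine.Point.map j.1 P =
        ∑ j : L →ₐ[K] Ω, Affine.Point.map j P := by
    rw [← finsum_eq_sum_of_fintype]
    exact finsum_comp_equiv (f := fun j : L →ₐ[K] Ω => Affine.Point.map j P)
      (Equiv.subtypeUnivEquiv fun j x => by rw [AlgHom.commutes]; exact (i.commutes x).symm)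
  constructor
  · intro h Ω _ _ _
    rw [h Ω, key]
  · intro h Ω _ _ _ i
    rw [key, ← h Ω, Subsingleton.elim i (Algebra.ofId K Ω)]

lemma isTrace_unique [FiniteDimensional K L] {P : (E⁄L).toAffine.Point}
    {R R' : (E⁄K).toAffine.Point} (h : IsTrace E P R) (h' : IsTrace E P R') : R = R' := by
  apply Affine.Point.map_injective (Algebra.ofId K (AlgebraicClosure K))
  rw [isTrace_iff.1 h, isTrace_iff.1 h']

/-- The sum has one term, since `i` extends uniquely to `L`, and the inseparable degree is the full
degree. -/
lemma isTrace_of_map_eq_finrank_nsmul [FiniteDimensional F L] [IsPurelyInseparable F L]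
    {P : (E⁄L).toAffine.Point} {Q : (E⁄F).toAffine.Point}
    (h : Affine.Point.map (IsScalarTower.toAlgHom K F L) Q = Module.finrank F L • P) :
    IsTrace E P Q := by
  intro Ω _ _ _ i
  obtain ⟨j, hj⟩ := (bijective_comp_toAlgHom (K := K) (F := F) (L := L) Ω).2 i
  let : Unique {j : L →ₐ[K] Ω // ∀ x : F, j (algebraMap F L x) = i x} :=
    { default := ⟨j, fun x => DFunLike.congr_fun hj x⟩
      uniq := fun j' => Subtype.ext
        ((bijective_comp_toAlgHom (K := K) (F := F) (L := L) Ω).1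
          ((AlgHom.ext j'.2 : j'.1.comp (IsScalarTower.toAlgHom K F L) = i).trans hj.symm)) }
  rw [finsum_unique, IsPurelyInseparable.finInsepDegree_eq, ← map_nsmul, ← h, Affine.Point.map_map]
  exact congrArg (fun f => Affine.Point.map f Q) hj.symm

end PurelyInseparable

end EllTrace

/-! ### Descent along `K(θ ^ p ^ d)` and assembly of the trace -/

namespace EllTrace

section Height

variable {K N L : Type u} [Field K] [Field N] [Field L] [Algebra K N] [Algebra K L]
  {p d : ℕ} [ExpChar K p] {φ : N →ₐ[K] L}

lemma bijective_comp_algHom (hq : ∀ a : L, a ^ p ^ d ∈ φ.range) (Ω : Type u) [Field Ω]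
    [IsAlgClosed Ω] [Algebra K Ω] : Function.Bijective fun j : L →ₐ[K] Ω => j.comp φ := by
  let : Algebra N L := φ.toRingHom.toAlgebra
  have : IsScalarTower K N L := .of_algebraMap_eq' φ.comp_algebraMap.symm
  have : ExpChar N p := expChar_of_injective_algebraMap (algebraMap K N).injective p
  have : IsPurelyInseparable N L := (isPurelyInseparable_iff_pow_mem N p).2 fun a => ⟨d, hq a⟩
  exact bijective_comp_toAlgHom (K := K) (F := N) (L := L) Ω

theorem exists_map_eq_pow_nsmul {E : WeierstrassCurve K} [E.IsElliptic]
    (hq : ∀ a : L, a ^ p ^ d ∈ φ.range) (P : (E⁄L).toAffine.Point) :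
    ∃ Q : (E⁄N).toAffine.Point, Affine.Point.map φ Q = p ^ d • P := by
  let : Algebra N L := φ.toRingHom.toAlgebra
  have : IsScalarTower K N L := .of_algebraMap_eq' φ.comp_algebraMap.symm
  -- Here `hq` says that `φ` is surjective; this covers characteristic zero and `d = 0`.
  by_cases h1 : p ^ d = 1
  · rw [h1, one_nsmul]
    simp only [h1, pow_one] at hq
    rcases P with _ | ⟨x, y, h⟩
    · exact ⟨0, rfl⟩
    · obtain ⟨x, rfl⟩ := hq x
      obtain ⟨y, rfl⟩ := hq y
      exact some_mem_range (F := N) h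
  · have hp : p.Prime := by
      rcases expChar_is_prime_or_one K p with h | h
      · exact h
      · exact absurd (by rw [h, one_pow]) h1
    have : Fact p.Prime := ⟨hp⟩
    have : ExpChar N p := expChar_of_injective_algebraMap (algebraMap K N).injective p
    have : CharP N p := by
      cases ‹ExpChar N p› with
      | zero => exact absurd rfl hp.ne_one
      | prime _ => assumption
    exact pow_nsmul_mem_range (fun hd => h1 (by rw [hd, pow_zero])) hq P

end Height

section Contraction

variable {K : Type u} [Field K] {p d : ℕ} {S T : K[X]}

lemma irreducible_of_eq_expand [ExpChar K p] (hT : Irreducible T) (h : T = expand K (p ^ d) S) :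
    Irreducible S :=
  of_irreducible_expand (pow_ne_zero d (expChar_ne_zero K p)) (h ▸ hT)

/-- A larger exponent would make `S` a polynomial in `t ^ p`, with zero derivative, against
separability. -/
lemma isGreatest_exponent [ExpChar K p] (hp : p ≠ 1) (hT : Irreducible T)
    (h : T = expand K (p ^ d) S) (hS : S.Separable) :
    IsGreatest {e : ℕ | ∃ S' : K[X], T = expand K (p ^ e) S'} d := by
  refine ⟨⟨S, h⟩, ?_⟩
  rintro e ⟨S', hS'⟩
  by_contra! hde
  obtain ⟨k, rfl⟩ := Nat.exists_eq_add_of_lt hde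
  have hp0 := expChar_ne_zero K p
  have hpp : p.Prime := (expChar_is_prime_or_one K p).resolve_right hp
  have hK : CharP K p := by
    cases ‹ExpChar K p› with
    | zero => exact absurd rfl hp
    | prime _ => assumption
  have hSS : S = expand K (p ^ (k + 1)) S' := by
    apply expand_injective (pow_pos hpp.pos d)
    rw [← h, hS', expand_expand, ← pow_add, add_assoc]
  apply (separable_iff_derivative_ne_zero (irreducible_of_eq_expand hT h)).1 hS
  have h0 : ((p ^ (k + 1) : ℕ) : K[X]) = 0 := by
    rw [pow_succ, Nat.cast_mul, CharP.cast_eq_zero K[X] p, mul_zero]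
  rw [hSS, derivative_expand, h0, zero_mul, mul_zero]

lemma exists_algHom_root_eq_pow (h : T = expand K (p ^ d) S) :
    ∃ φ : AdjoinRoot S →ₐ[K] AdjoinRoot T, φ (AdjoinRoot.root S) = AdjoinRoot.root T ^ p ^ d := by
  refine ⟨AdjoinRoot.liftAlgHom S (Algebra.ofId K _) (AdjoinRoot.root T ^ p ^ d) ?_,
    AdjoinRoot.liftAlgHom_root ..⟩
  change aeval (AdjoinRoot.root T ^ p ^ d) S = 0
  rw [← expand_aeval, ← h, AdjoinRoot.aeval_eq, AdjoinRoot.mk_self]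

variable {φ : AdjoinRoot S →ₐ[K] AdjoinRoot T}

lemma pow_mem_range [ExpChar K p] [Fact (Irreducible T)]
    (hφ : φ (AdjoinRoot.root S) = AdjoinRoot.root T ^ p ^ d) (a : AdjoinRoot T) :
    a ^ p ^ d ∈ φ.range := by
  have : ExpChar (AdjoinRoot T) p :=
    expChar_of_injective_algebraMap (algebraMap K (AdjoinRoot T)).injective p
  induction a using AdjoinRoot.induction_on with
  | _ g =>
    induction g using Polynomial.induction_on' with
    | add f g hf hg =>
      rw [map_add, add_pow_expChar_pow]
      exact add_mem hf hg
    | monomial n c =>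
      rw [← AdjoinRoot.aeval_eq, aeval_monomial, mul_pow, ← pow_mul, mul_comm n, pow_mul, ← hφ]
      exact mul_mem (pow_mem (φ.range.algebraMap_mem c) _) (pow_mem (φ.mem_range_self _) _)

variable [Fact (Irreducible S)] [Fact (Irreducible T)]

lemma adjoin_eq_fieldRange (φ : AdjoinRoot S →ₐ[K] AdjoinRoot T) :
    K⟮φ (AdjoinRoot.root S)⟯ = φ.fieldRange := by
  ext y
  rw [mem_adjoin_simple_iff_exists_aeval (Algebra.IsIntegral.isIntegral _), AlgHom.mem_fieldRange]
  simp only [aeval_algHom_apply, AdjoinRoot.aeval_eq]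
  constructor
  · rintro ⟨g, rfl⟩
    exact ⟨_, rfl⟩
  · rintro ⟨x, rfl⟩
    obtain ⟨g, -, rfl⟩ := exists_degree_lt_mk_eq x
    exact ⟨g, rfl⟩

lemma exists_algEquiv {M : IntermediateField K (AdjoinRoot T)} (hM : M = φ.fieldRange) :
    ∃ e : AdjoinRoot S ≃ₐ[K] M, M.val.comp (e : AdjoinRoot S →ₐ[K] M) = φ := by
  subst hM
  exact ⟨AlgEquiv.ofInjectiveField φ, rfl⟩

lemma finrank_eq_of_algEquiv (h : T = expand K (p ^ d) S)
    {M : IntermediateField K (AdjoinRoot T)} (e : AdjoinRoot S ≃ₐ[K] M) :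
    Module.finrank M (AdjoinRoot T) = p ^ d := by
  have h1 := Module.finrank_mul_finrank K M (AdjoinRoot T)
  have hS : 0 < S.natDegree := (Fact.out : Irreducible S).natDegree_pos
  rw [← e.toLinearEquiv.finrank_eq, finrank_adjoinRoot, finrank_adjoinRoot,
    congrArg natDegree h, natDegree_expand] at h1
  exact Nat.eq_of_mul_eq_mul_left hS h1

lemma isPurelyInseparable_of_pow_mem [ExpChar K p] {M : IntermediateField K (AdjoinRoot T)}
    (hM : M = φ.fieldRange) (hq : ∀ a : AdjoinRoot T, a ^ p ^ d ∈ φ.range) :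
    IsPurelyInseparable M (AdjoinRoot T) := by
  have : ExpChar M p := expChar_of_injective_algebraMap (algebraMap K M).injective p
  refine (isPurelyInseparable_iff_pow_mem M p).2 fun a => ⟨d, ?_⟩
  subst hM
  obtain ⟨b, hb⟩ := hq a
  exact ⟨⟨φ b, b, rfl⟩, hb⟩

end Contraction

section Main

variable {K : Type u} [Field K] {E : WeierstrassCurve K} [E.IsElliptic] {p d : ℕ} [ExpChar K p]
  {S T : K[X]} [Fact (Irreducible T)]

theorem exists_isTrace (ker : KernelRoutine K) (h : T = expand K (p ^ d) S) (hS : S.Separable)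
    (P : (E⁄(AdjoinRoot T)).toAffine.Point) :
    ∃ R : (E⁄K).toAffine.Point, IsTrace E P R ∧
      Field.finInsepDegree K (AdjoinRoot T) = p ^ d ∧
      K⟮AdjoinRoot.root T ^ p ^ d⟯ = separableClosure K (AdjoinRoot T) ∧
      (∃ Q : (E⁄K⟮AdjoinRoot.root T ^ p ^ d⟯).toAffine.Point,
        Affine.Point.map K⟮AdjoinRoot.root T ^ p ^ d⟯.val Q = p ^ d • P ∧
        IsTrace E P Q ∧ IsTrace E Q R) ∧
      (p ^ d • P = 0 → R = 0) ∧
      (p ^ d • P ≠ 0 →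
        ∃ f : K[X] × K[X],
          (∀ g : K[X] × K[X],
            (g.1.degree < S.degree ∧ g.2.degree < S.degree ∧
              HasCoords E (AdjoinRoot.root T ^ p ^ d) (p ^ d • P) g) ↔ g = f) ∧
          (E⁄(AdjoinRoot S)).toAffine.Equation
            (aeval (AdjoinRoot.root S) f.1) (aeval (AdjoinRoot.root S) f.2) ∧
          ellTraceSep ker E S f.1 f.2 = some R) := by
  have : Fact (Irreducible S) := ⟨irreducible_of_eq_expand Fact.out h⟩
  obtain ⟨φ, hφ⟩ := exists_algHom_root_eq_pow h
  have hq := pow_mem_range hφ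
  obtain ⟨Q, hQ⟩ := exists_map_eq_pow_nsmul hq P
  obtain ⟨R, hR, hsep⟩ := exists_trace ker hS Q
  have hM := adjoin_eq_fieldRange φ
  rw [← hQ, ← hφ]
  -- The type of the intermediate point depends on this field; as a variable `M` it can be
  -- identified with the range of `φ`.
  generalize K⟮φ (AdjoinRoot.root S)⟯ = M at hM ⊢
  obtain ⟨e, he⟩ := exists_algEquiv hM
  have hrank := finrank_eq_of_algEquiv h e
  have := isPurelyInseparable_of_pow_mem hM hq
  have := adjoinRoot_isSeparable hS
  have : Algebra.IsSeparable K M := .of_algHom K _ (e.symm : M →ₐ[K] AdjoinRoot S)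
  have hcl := eq_separableClosure K (AdjoinRoot T) M
  have hins : Field.finInsepDegree K (AdjoinRoot T) = p ^ d := by
    rw [Field.finInsepDegree, ← hcl, hrank]
  refine ⟨R, ?_, hins, hcl, ⟨Affine.Point.map (e : AdjoinRoot S →ₐ[K] M) Q, ?_, ?_, ?_⟩, ?_, ?_⟩
  · refine isTrace_iff.2 fun Ω _ _ _ => ?_
    -- Restriction along `φ` is a bijection from embeddings of `K[t]/T` to embeddings of `K[t]/S`;
    -- the factor `p ^ d` then moves inside and becomes `Q`.
    rw [hR, hins, Finset.smul_sum, ← (bijective_comp_algHom hq Ω).sum_comp]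
    refine Finset.sum_congr rfl fun j _ => ?_
    rw [← map_nsmul, ← hQ, Affine.Point.map_map]
  · rw [Affine.Point.map_map, he]
  · apply isTrace_of_map_eq_finrank_nsmul
    rw [hrank, ← hQ]
    exact (Affine.Point.map_map (e : AdjoinRoot S →ₐ[K] M) M.val Q).trans
      (congrArg (fun f => Affine.Point.map f Q) he)
  · refine isTrace_iff.2 fun Ω _ _ _ => ?_
    rw [hR, Algebra.IsSeparable.finInsepDegree_eq, one_nsmul,
      ← (e.arrowCongr (AlgEquiv.refl (A₁ := Ω))).symm.bijective.sum_comp]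
    refine Finset.sum_congr rfl fun j _ => ?_
    exact (Affine.Point.map_map (e : AdjoinRoot S →ₐ[K] M) j Q).symm
  · intro h0
    have hQ0 : Q = 0 := Affine.Point.map_injective φ (h0.trans (map_zero _).symm)
    apply Affine.Point.map_injective (Algebra.ofId K (AlgebraicClosure K))
    rw [hR, hQ0, map_zero]
    simp only [map_zero, Finset.sum_const_zero]
  · intro h0
    have hQ0 : Q ≠ 0 := fun h1 => h0 (by rw [h1, map_zero])
    obtain ⟨f, hf⟩ := exists_hasCoords_iff hQ0
    obtain ⟨h1, h2, h3⟩ := (hf f).2 rfl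
    refine ⟨f, fun g => ?_, h3.choose, hsep f h1 h2 h3⟩
    rw [hasCoords_map_iff, hf]

end Main

end EllTrace

/-! ### The full algorithm -/

namespace EllTrace

variable {K : Type u} [Field K]

/-- Shows that the bounded search for the exponent in `ellTrace` misses nothing. -/
lemma le_natDegree_of_eq_expand {p e : ℕ} (hp : 1 < p) {T S : K[X]} (hT : Irreducible T)
    (h : T = expand K (p ^ e) S) : e ≤ T.natDegree := by
  have hpos := hT.natDegree_pos
  have hdeg := natDegree_expand (p ^ e) S
  rw [← h] at hdeg
  have hS : 0 < S.natDegree := Nat.pos_of_ne_zero fun h0 => by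
    rw [h0, zero_mul] at hdeg
    exact hpos.ne' hdeg
  calc e ≤ p ^ e := (Nat.lt_pow_self hp).le
    _ ≤ S.natDegree * p ^ e := Nat.le_mul_of_pos_left _ hS
    _ = T.natDegree := hdeg.symm

lemma findGreatest_exponent {p d : ℕ} (hp : 1 < p) {T : K[X]} (hT : Irreducible T)
    (h : IsGreatest {e : ℕ | ∃ S : K[X], T = expand K (p ^ e) S} d) :
    Nat.findGreatest (fun e => ∃ S : K[X], T = expand K (p ^ e) S) T.natDegree = d := by
  obtain ⟨S, hS⟩ := h.1
  have hd := le_natDegree_of_eq_expand hp hT hS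
  exact le_antisymm
    (h.2 (Nat.findGreatest_spec (P := fun e => ∃ S : K[X], T = expand K (p ^ e) S) hd h.1))
    (Nat.le_findGreatest hd h.1)

lemma exists_separable_eq_expand (p : ℕ) [ExpChar K p] {T : K[X]} (hT : Irreducible T) :
    ∃ (d : ℕ) (S : K[X]), T = expand K (p ^ d) S ∧ S.Separable := by
  obtain ⟨S, hS, d, h⟩ := hT.hasSeparableContraction p
  exact ⟨d, S, h.symm, hS⟩

theorem ellTrace_eq (ker : KernelRoutine K) {E : WeierstrassCurve K} [E.IsElliptic] {T : K[X]}
    [Fact (Irreducible T)] {xP yP : K[X]} (hx : xP.degree < T.degree) (hy : yP.degree < T.degree)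
    (hP : (E⁄(AdjoinRoot T)).toAffine.Equation
      (aeval (AdjoinRoot.root T) xP) (aeval (AdjoinRoot.root T) yP))
    {R : (E⁄K).toAffine.Point} (hR : IsTrace E (Affine.Point.mk hP) R) :
    ellTrace ker E T xP yP hP = some R := by
  have hT : Irreducible T := Fact.out
  have hchar := ringChar.charP K
  rcases CharP.char_is_prime_or_zero K (ringChar K) with hp | hp
  · have : ExpChar K (ringChar K) := .prime hp
    obtain ⟨d, S, h, hS⟩ := exists_separable_eq_expand (ringChar K) hT
    obtain ⟨R', hR', -, -, -, h0, h1⟩ := exists_isTrace ker h hS (Affine.Point.mk hP)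
    obtain rfl := isTrace_unique hR hR'
    have hd := findGreatest_exponent hp.one_lt hT (isGreatest_exponent hp.ne_one hT h hS)
    have hc : contract (ringChar K ^ d) T = S := by
      rw [h]
      exact contract_expand _ (pow_ne_zero d hp.ne_zero)
    simp only [ellTrace, ne_eq, hp.ne_zero, not_false_eq_true, if_true, hd, hc]
    split_ifs with hQ hf
    · rw [h0 hQ]
    · obtain ⟨f, hf', -, hfR⟩ := h1 hQ
      rw [(hf' _).1 hf.choose_spec, hfR]
    · obtain ⟨f, hf', -, -⟩ := h1 hQ
      exact absurd ⟨f, (hf' f).2 rfl⟩ hf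
  · have : CharZero K := (CharP.ringChar_zero_iff_CharZero (R := K)).1 hp
    obtain ⟨d, S, h, hS⟩ := exists_separable_eq_expand 1 hT
    have hST : S = T := by rw [h, one_pow, expand_one]
    subst hST
    obtain ⟨R', hR', -, -, -, -, h1⟩ := exists_isTrace ker h hS (Affine.Point.mk hP)
    obtain rfl := isTrace_unique hR hR'
    obtain ⟨f, hf, -, hfR⟩ := h1 (by
      rw [one_pow, one_nsmul]
      exact Affine.Point.some_ne_zero _)
    -- In characteristic zero `Q = P` and `S = T`, so uniqueness of coordinates identifies the input
    -- pair with `f`.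
    have hf' : (xP, yP) = f := (hf _).1 ⟨hx, hy, by
      rw [one_pow, pow_one, one_nsmul]
      exact ⟨hP, rfl⟩⟩
    subst hf'
    simp only [ellTrace, ne_eq, hp, not_true_eq_false, if_false]
    exact hfR

end EllTrace

theorem mainTheorem2 {K : Type u} [Field K] (E : WeierstrassCurve K) [E.IsElliptic]
    (ker : KernelRoutine K) (T : K[X]) [Fact (Irreducible T)] (xP yP : K[X])
    (hx : xP.degree < T.degree) (hy : yP.degree < T.degree)
    (hP : (E⁄(AdjoinRoot T)).toAffine.Equation
      (aeval (AdjoinRoot.root T) xP) (aeval (AdjoinRoot.root T) yP)) :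
    let θ : AdjoinRoot T := AdjoinRoot.root T
    let P : (E⁄(AdjoinRoot T)).toAffine.Point := Affine.Point.mk hP
    ∃ R : (E⁄K).toAffine.Point,
      IsTrace E P R ∧
      ellTrace ker E T xP yP hP = some R ∧
      ∀ (p : ℕ) [ExpChar K p],
        (∃ (d : ℕ) (S : K[X]), T = expand K (p ^ d) S ∧ S.Separable) ∧
        ∀ (d : ℕ) (S : K[X]), T = expand K (p ^ d) S → S.Separable →
          Irreducible S ∧
          (p ≠ 1 → IsGreatest {e : ℕ | ∃ S' : K[X], T = expand K (p ^ e) S'} d) ∧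
          Field.finInsepDegree K (AdjoinRoot T) = p ^ d ∧
          K⟮θ ^ p ^ d⟯ = separableClosure K (AdjoinRoot T) ∧
          (∃ Q : (E⁄K⟮θ ^ p ^ d⟯).toAffine.Point,
            Affine.Point.map K⟮θ ^ p ^ d⟯.val Q = p ^ d • P ∧
            IsTrace E P Q ∧
            IsTrace E Q R) ∧
          (p ^ d • P ≠ 0 →
            ∃ f : K[X] × K[X],
              (∀ g : K[X] × K[X],
                (g.1.degree < S.degree ∧ g.2.degree < S.degree ∧
                  HasCoords E (θ ^ p ^ d) (p ^ d • P) g) ↔ g = f) ∧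
              (E⁄(AdjoinRoot S)).toAffine.Equation
                (aeval (AdjoinRoot.root S) f.1) (aeval (AdjoinRoot.root S) f.2) ∧
              ellTraceSep ker E S f.1 f.2 = some R) := by
  intro θ P
  have hT : Irreducible T := Fact.out
  -- `R` is fixed before `p`, `d` and `S` vary; `isTrace_unique` later identifies it with the point
  -- obtained for each choice.
  obtain ⟨R, hR⟩ : ∃ R, IsTrace E P R := by
    obtain ⟨p, _⟩ := ExpChar.exists K
    obtain ⟨d, S, h, hS⟩ := EllTrace.exists_separable_eq_expand p hT
    obtain ⟨R, hR, -⟩ := EllTrace.exists_isTrace ker h hS P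
    exact ⟨R, hR⟩
  refine ⟨R, hR, EllTrace.ellTrace_eq ker hx hy hP hR, fun p _ =>
    ⟨EllTrace.exists_separable_eq_expand p hT, fun d S h hS => ?_⟩⟩
  obtain ⟨R', hR', hins, hcl, hQ, -, hf⟩ := EllTrace.exists_isTrace ker h hS P
  obtain rfl := EllTrace.isTrace_unique hR hR'
  exact ⟨EllTrace.irreducible_of_eq_expand hT h,
    fun hp => EllTrace.isGreatest_exponent hp hT h hS, hins, hcl, hQ, hf⟩
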